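/- **Setting.** An aerial transmitter $R$ hovers at altitude $w_r>0$ above the Earth, whose radius is $w_e>0$; put $w_{er}=w_e+w_r$. A satellite $S$ is uniformly distributed, with respect to surface measure, on the part above the horizontal plane through $R$ of the sphere of radius $w_{er}+w_{\min}$ around the Earth's centre ($w_{\min}>0$); put $w_{\max}=\sqrt{w_{\min}^2+2w_{er}w_{\min}}$. An aerial receiver $T$ is uniformly distributed in the part at vertical depths between $h_1$ and $h_2$ ($0<h_1<h_2$) below $R$ of the solid cone with apex $R$, vertical axis pointing downwards and half-angle $\phi\in(0,\pi/2)$. Let $w_{sr}=|S-R|$ and $w_{rt}=|T-R|$. The complex channel coefficients $g_{sr}$, $g_{rt}$ and the positions $S$, $T$ are independent. With $m_{sr}\in\{1,2,\dots\}$, $b_{sr}>0$, $\Omega_{sr}\ge 0$, $K\ge 0$, the pdfs on $x>0$ are $$f_{|g_{sr}|^2}(x)=\alpha_{sr}\sum_{k=0}^{m_{sr}-1}\zeta(k)x^k e^{-\bar\beta x},\qquad f_{|g_{rt}|^2}(x)=(1+K)e^{-K-(1+K)x}I_0\big(2\sqrt{K(1+K)x}\big),$$ where $\alpha_{sr}=\frac1{2b_{sr}}\Big(\frac{2b_{sr}m_{sr}}{2b_{sr}m_{sr}+\Omega_{sr}}\Big)^{m_{sr}}$,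 $\delta=\frac{\Omega_{sr}}{2b_{sr}(2b_{sr}m_{sr}+\Omega_{sr})}$, $\bar\beta=\frac1{2b_{sr}}-\delta$, $\zeta(k)=(-1)^k(1-m_{sr})_k\,\delta^k/(k!)^2$ with the Pochhammer symbol $(\cdot)_k$, and $I_0$ is the modified Bessel function of the first kind of order zero. Let $\chi,\mu\in(0,1)$, $\rho,\varepsilon\in[0,1)$ not both zero, and $\eta_s,\nu,\sigma_r^2,\sigma_{rb}^2,\sigma_t^2,\mathcal P_{th},\gamma_A>0$. Put $\chi_{\rho,\varepsilon}=\chi\big(\frac{2\rho}{1-\rho}+\varepsilon\big)$, $\mu'=\frac{\mu}{1-\mu}$, $\mu_\varepsilon=\mu\big(\sigma_r^2+\frac{\sigma_{rb}^2}{1-\varepsilon}\big)$, $\mathcal D=\mu_\varepsilon\chi_{\rho,\varepsilon}\gamma_A$, $\mathcal E=\chi_{\rho,\varepsilon}\eta_s(1-\mu)$, $\mathcal P=\mathcal P_{th}\mathcal E/\eta_s-\mathcal D$, $\Theta=(1+K)\sigma_t^2\gamma_A$. In the linear regime of the energy harvester the SNR at $T$ under perfect interference cancellation is $$\Lambda=\frac{(1-\mu)\chi_{\rho,\varepsilon}\,\eta_s|g_{sr}|^2w_{sr}^{-2}\,|g_{rt}|^2w_{rt}^{-\nu}}{\mu_\varepsilon\chi_{\rho,\varepsilon}|g_{rt}|^2w_{rt}^{-\nu}+\sigma_t^2},$$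 and $\mathcal P_5(\gamma_A)=\Pr\big[\Lambda>\gamma_A,\ \eta_s|g_{sr}|^2w_{sr}^{-2}\le\mathcal P_{th}\big]$. **Theorem.** $$\mathcal P_5(\gamma_A)=\begin{cases}\overline\Psi_1(\gamma_A),&\gamma_A<1/\mu'\ \text{and}\ \mathcal P_{th}\ge(\mathcal D/\mathcal E)\eta_s,\\ 0,&\mathcal P_{th}<(\mathcal D/\mathcal E)\eta_s,\end{cases}$$ where, for $\gamma_A<1/\mu'$ and $\mathcal P_{th}>(\mathcal D/\mathcal E)\eta_s$, all infinite series below converge absolutely and $$\begin{aligned}\overline\Psi_1(\gamma_A)={}&\frac{3\,\mathcal E\,\alpha_{sr}}{w_{er}w_{\min}\,\nu\,(h_2^3-h_1^3)\tan^2\phi}\sum_{k=0}^{m_{sr}-1}\frac{\zeta(k)e^{-K}}{\bar\beta^{\,k+2}}\sum_{m=0}^\infty\sum_{n=0}^m\frac{K^m\Theta^n}{m!\,n!}\sum_{k_1=0}^k\binom k{k_1}\\&\times\sum_{k_2=0}^\infty\frac{(-1)^{k_2}}{k_2!}\frac{\mathcal P^{\varsigma_1}}{\mathcal D^{k_1+k_2+2}}\Big[\Gamma\Big(k+k_2+2,\tfrac{\bar\beta\mathcal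 Dw_{\min}^2}{\mathcal E}\Big)-\Gamma\Big(k+k_2+2,\tfrac{\bar\beta\mathcal Dw_{\max}^2}{\mathcal E}\Big)\Big]\,B_{n,\varsigma_1},\end{aligned}$$ with $\varsigma_1=1+k_1+k_2-n$, the upper incomplete Gamma function $\Gamma(\cdot,\cdot)$, and, for $$G_j(h)=G^{2,1}_{2,3}\left[\frac{\Theta h^\nu}{\mathcal P}\,\middle|\,{1-n-\frac j\nu,\ \varsigma_1+1\atop \varsigma_1,\ 0,\ -n-\frac j\nu}\right]\quad\text{(Meijer G-function)},\qquad a_i=\frac{h_i}{\cos\phi},$$ $$\begin{aligned}B_{n,\varsigma_1}={}&h_2^{\nu n+3}G_3(h_2)-h_1^{\nu n+3}G_3(h_1)-h_1a_1^{\nu n+2}G_2(a_1)+h_1^{\nu n+3}G_2(h_1)\\&-\cos\phi\;a_2^{\nu n+3}G_3(a_2)+\cos\phi\;a_1^{\nu n+3}G_3(a_1)+h_2a_2^{\nu n+2}G_2(a_2)-h_2^{\nu n+3}G_2(h_2).\end{aligned}$$ In the boundary case $\gamma_A<1/\mu'$, $\mathcal P_{th}=(\mathcal D/\mathcal E)\eta_s$,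 where $\mathcal P=0$, $\overline\Psi_1$ is read as its limit as $\mathcal P_{th}$ decreases to $(\mathcal D/\mathcal E)\eta_s$, and this limit and $\mathcal P_5(\gamma_A)$ are both $0$. -/

import Mathlib

open MeasureTheory ProbabilityTheory Filter Topology

noncomputable section

namespace A2A

/-! ### Special functions -/

/-- The upper incomplete Gamma function `Γ(a, x) = ∫_x^∞ t^(a-1) e^(-t) dt`. -/
def upperGamma (a x : ℝ) : ℝ :=
  ∫ t in Set.Ioi x, t ^ (a - 1) * Real.exp (-t)

/-- `Δ_Γ(a, b, c) = Γ(a, b) - Γ(a, c)`. -/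
def deltaGamma (a b c : ℝ) : ℝ := upperGamma a b - upperGamma a c

/-- The zeroth-order modified Bessel function of the first kind,
`I₀(z) = ∑ₘ (z/2)^(2m) / (m!)²`. -/
def besselI0 (z : ℝ) : ℝ :=
  ∑' m : ℕ, (z / 2) ^ (2 * m) / ((Nat.factorial m : ℝ) ^ 2)

/-- The Mellin-Barnes integrand of the Meijer function `G^{m,n}_{p,q}`. The upper parameters are
`a` (the first `n`) and `a'` (the other `p - n`), the lower ones `b` (the first `m`) and `b'`
(the other `q - m`):
`∏_b Γ(b-s) ∏_a Γ(1-a+s) / (∏_{b'} Γ(1-b'+s) ∏_{a'} Γ(a'-s)) · x^s`.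
(At a pole of a Gamma function in the denominator the quotient is `0`, as it should be.) -/
def meijerIntegrand (a a' b b' : List ℝ) (x : ℝ) (s : ℂ) : ℂ :=
  (b.map fun β => Complex.Gamma ((β : ℂ) - s)).prod *
      (a.map fun α => Complex.Gamma (1 - (α : ℂ) + s)).prod /
    ((b'.map fun β => Complex.Gamma (1 - (β : ℂ) + s)).prod *
      (a'.map fun α => Complex.Gamma ((α : ℂ) - s)).prod) * (x : ℂ) ^ s

/-- The vertical line `Re s = c` separates the poles of the `Γ(1-a+s)` (on its left) from those
of the `Γ(b-s)` (on its right). -/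
def IsSeparating (a b : List ℝ) (c : ℝ) : Prop :=
  (∀ α ∈ a, α - 1 < c) ∧ (∀ β ∈ b, c < β)

open Classical in
/-- The Meijer G-function `G^{m,n}_{p,q}[x | a, a' ; b, b']` with real parameters at `x > 0`,
`(2πi)⁻¹ ∫ meijerIntegrand ds` along a vertical line that separates the two families of poles.
The integral converges absolutely if `2 (m + n) > p + q`, does not depend on the line chosen,
and is real. (The value is set to `0` if no vertical line separates the poles.) -/
def meijerG (a a' b b' : List ℝ) (x : ℝ) : ℝ :=
  if h : ∃ c : ℝ, IsSeparating a b c then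
    ((1 / (2 * (Real.pi : ℂ))) *
      ∫ t : ℝ, meijerIntegrand a a' b b' x ((h.choose : ℂ) + (t : ℂ) * Complex.I)).re
  else 0

/-! ### System parameters -/

/-- The parameters of the network, except the saturation threshold power and the target
threshold. -/
structure Params where
  /-- energy conversion efficiency -/
  χ : ℝ
  /-- time splitting factor -/
  ρ : ℝ
  /-- power splitting factor -/
  ε : ℝ
  /-- spectrum sharing factor -/
  μ : ℝ
  /-- effective transmit power `η_s` of the satellite -/
  ηs : ℝ
  /-- noise variance `σ_r²` at the aerial transmitter -/
  σr2 : ℝ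
  /-- variance `σ_rb²` of the RF-to-baseband conversion noise -/
  σrb2 : ℝ
  /-- noise variance `σ_t²` at the aerial receiver -/
  σt2 : ℝ
  /-- fading severity `m_sr` of the satellite link -/
  msr : ℕ
  /-- half of the average power of the multipath component of the satellite link -/
  bsr : ℝ
  /-- average power `Ω_sr` of the line-of-sight component of the satellite link -/
  Ωsr : ℝ
  /-- Rician factor `K_rt` -/
  K : ℝ
  /-- path loss exponent `ν_rt` -/
  ν : ℝ
  /-- radius of the Earth -/
  we : ℝ
  /-- altitude of the aerial transmitter -/
  wr : ℝ
  /-- minimal distance between the satellite and the aerial transmitter -/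
  wmin : ℝ
  /-- vertical distance from the aerial transmitter to the upper face of the region of the aerial
  receiver -/
  h1 : ℝ
  /-- vertical distance from the aerial transmitter to the lower face of that region -/
  h2 : ℝ
  /-- half-beamwidth angle of the conical coverage -/
  φ : ℝ

/-- The ranges of the parameters. The condition `0 < ρ ∨ 0 < ε` says that some energy is
harvested. -/
structure Params.Admissible (p : Params) : Prop where
  χ_pos : 0 < p.χ
  χ_lt : p.χ < 1
  ρ_nonneg : 0 ≤ p.ρ
  ρ_lt : p.ρ < 1
  ε_nonneg : 0 ≤ p.ε
  ε_lt : p.ε < 1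
  harvests : 0 < p.ρ ∨ 0 < p.ε
  μ_pos : 0 < p.μ
  μ_lt : p.μ < 1
  ηs_pos : 0 < p.ηs
  σr2_pos : 0 < p.σr2
  σrb2_pos : 0 < p.σrb2
  σt2_pos : 0 < p.σt2
  msr_pos : 1 ≤ p.msr
  bsr_pos : 0 < p.bsr
  Ωsr_nonneg : 0 ≤ p.Ωsr
  K_nonneg : 0 ≤ p.K
  ν_pos : 0 < p.ν
  we_pos : 0 < p.we
  wr_pos : 0 < p.wr
  wmin_pos : 0 < p.wmin
  h1_pos : 0 < p.h1
  h1_lt : p.h1 < p.h2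
  φ_pos : 0 < p.φ
  φ_lt : p.φ < Real.pi / 2

namespace Params

variable (p : Params)

/-- `χ_{ρ,ε} = χ (2ρ/(1-ρ) + ε)` -/
def χρε : ℝ := p.χ * (2 * p.ρ / (1 - p.ρ) + p.ε)

/-- `μ' = μ/(1-μ)` -/
def μ' : ℝ := p.μ / (1 - p.μ)

/-- `μ_ε = μ (σ_r² + σ_rb²/(1-ε))` -/
def με : ℝ := p.μ * (p.σr2 + p.σrb2 / (1 - p.ε))

/-- `α_sr` -/
def αsr : ℝ :=
  (2 * p.bsr * p.msr / (2 * p.bsr * p.msr + p.Ωsr)) ^ p.msr / (2 * p.bsr)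

/-- `β_sr` -/
def βsr : ℝ := 1 / (2 * p.bsr)

/-- `δ_sr` -/
def δsr : ℝ := p.Ωsr / ((2 * p.bsr) * (2 * p.bsr * p.msr + p.Ωsr))

/-- `β̄_sr = β_sr - δ_sr` -/
def βbar : ℝ := p.βsr - p.δsr

/-- `ζ(k) = (-1)^k (1-m_sr)_k δ_sr^k / (k!)²`, with the Pochhammer symbol `(·)_k` -/
def ζ (k : ℕ) : ℝ :=
  (-1) ^ k * (ascPochhammer ℝ k).eval (1 - (p.msr : ℝ)) * p.δsr ^ k /
    ((Nat.factorial k : ℝ) ^ 2)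

/-- `w_er = w_e + w_r`, the distance from the centre of the Earth to the aerial transmitter -/
def wer : ℝ := p.we + p.wr

/-- `w_max`, the maximal distance between the satellite and the aerial transmitter -/
def wmax : ℝ := Real.sqrt (p.wmin ^ 2 + 2 * p.wer * p.wmin)

/-- `𝒟 = μ_ε χ_{ρ,ε} γ` -/
def calD (γ : ℝ) : ℝ := p.με * p.χρε * γ

/-- `ℰ = χ_{ρ,ε} η_s (1-μ)` -/
def calE : ℝ := p.χρε * p.ηs * (1 - p.μ)

/-- `Θ(γ) = (1+K) σ_t² γ` -/
def Θ (γ : ℝ) : ℝ := (1 + p.K) * p.σt2 * γ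

end Params

/-! ### The probabilistic model

The aerial transmitter is at the origin; the third coordinate axis points upwards. -/

/-- Three-dimensional Euclidean space. -/
abbrev Space : Type := EuclideanSpace ℝ (Fin 3)

/-- The centre of the Earth. -/
def earthCentre (p : Params) : Space := EuclideanSpace.single 2 (-p.wer)

/-- The surface measure (up to a constant factor) of the sphere of radius `w_er + w_min` around
the centre of the Earth, as a measure on space. -/
def orbitSurface (p : Params) : Measure Space :=
  (volume : Measure Space).toSphere.map
    fun u : Metric.sphere (0 : Space) 1 => earthCentre p + (p.wer + p.wmin) • (u : Space)

/-- The part of that sphere that lies above the horizontal plane through the aerial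
transmitter. -/
def satelliteCap (p : Params) : Set Space :=
  {x | dist x (earthCentre p) = p.wer + p.wmin ∧ 0 ≤ x 2}

/-- The truncated cone with apex at the aerial transmitter, axis pointing downwards and half-angle
`φ`, between the horizontal planes at depths `h₁` and `h₂`. -/
def coverageRegion (p : Params) : Set Space :=
  {x | p.h1 ≤ -x 2 ∧ -x 2 ≤ p.h2 ∧ ‖x‖ * Real.cos p.φ ≤ -x 2}

/-- The pdf of `|g_sr|²` under Shadowed-Rician fading. -/
def shadowedRicianPDF (p : Params) (x : ℝ) : ℝ :=
  p.αsr * ∑ k ∈ Finset.range p.msr, p.ζ k * x ^ k * Real.exp (-(p.βsr - p.δsr) * x)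

/-- The pdf of `|g_rt|²` under Rician fading. -/
def ricianPDF (p : Params) (x : ℝ) : ℝ :=
  (1 + p.K) * Real.exp (-p.K - (1 + p.K) * x) *
    besselI0 (2 * Real.sqrt (p.K * (1 + p.K) * x))

/-- The law on the positive half-line with density `f`. -/
def lawOfPDF (f : ℝ → ℝ) : Measure ℝ :=
  (volume.restrict (Set.Ioi (0 : ℝ))).withDensity fun x => ENNReal.ofReal (f x)

/-- The random objects of the aerial network: the positions `S` of the satellite and `T` of the
aerial receiver, and the channel coefficients `gsr` and `grt`, all independent. -/
structure IsModel {Ω : Type*} [MeasurableSpace Ω] (P : Measure Ω) (p : Params)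
    (S T : Ω → Space) (gsr grt : Ω → ℂ) : Prop where
  measurable_S : Measurable S
  measurable_T : Measurable T
  measurable_gsr : Measurable gsr
  measurable_grt : Measurable grt
  satellite_uniform : pdf.IsUniform S (satelliteCap p) P (orbitSurface p)
  receiver_uniform : pdf.IsUniform T (coverageRegion p) P volume
  satellite_fading : HasLaw (fun ω => ‖gsr ω‖ ^ 2) (lawOfPDF (shadowedRicianPDF p)) P
  aerial_fading : HasLaw (fun ω => ‖grt ω‖ ^ 2) (lawOfPDF (ricianPDF p)) P
  independent :
    iIndep ![MeasurableSpace.comap S inferInstance, MeasurableSpace.comap T inferInstance,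
      MeasurableSpace.comap gsr inferInstance, MeasurableSpace.comap grt inferInstance] P

/-- The power `η_s |g_sr|² w_sr⁻²` received at the aerial transmitter from the satellite at `s`. -/
def rxPower (p : Params) (s : Space) (g : ℂ) : ℝ :=
  p.ηs * ‖g‖ ^ 2 * (‖s‖ ^ 2)⁻¹

/-- The gain `|g_rt|² w_rt^{-ν}` of the aerial link with the receiver at `t`. -/
def aerialGain (p : Params) (t : Space) (g : ℂ) : ℝ :=
  ‖g‖ ^ 2 * ‖t‖ ^ (-p.ν)

/-- The SNR `Λ^{p-IC}_{T,1}` at the aerial receiver under perfect interference cancellation in the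
linear regime of the energy harvester. -/
def snrPIC1 (p : Params) (s t : Space) (gs gt : ℂ) : ℝ :=
  (1 - p.μ) * p.χρε * rxPower p s gs * aerialGain p t gt /
    (p.με * p.χρε * aerialGain p t gt + p.σt2)

/-- `𝒫₅(γ) = Pr[Λ^{p-IC}_{T,1} > γ, η_s |g_sr|² w_sr⁻² ≤ P_th]`. -/
def P5 {Ω : Type*} [MeasurableSpace Ω] (P : Measure Ω) (p : Params)
    (S T : Ω → Space) (gsr grt : Ω → ℂ) (Pth γ : ℝ) : ℝ :=
  P.real {ω | γ < snrPIC1 p (S ω) (T ω) (gsr ω) (grt ω) ∧ rxPower p (S ω) (gsr ω) ≤ Pth}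

/-! ### The series -/

/-- `𝒫_{C,𝒟} = P_th C / η_s - 𝒟` -/
def calP (p : Params) (Pth γ C : ℝ) : ℝ := Pth * C / p.ηs - p.calD γ

/-- `G^{2,1}_{2,3}[Θ(γ) h^ν / 𝒫_{C,𝒟} | 1-n-j/ν, ς+1 ; ς, 0, -n-j/ν]` -/
def gTerm (p : Params) (Pth γ C : ℝ) (n : ℕ) (ς : ℤ) (j h : ℝ) : ℝ :=
  meijerG [1 - n - j / p.ν] [(ς : ℝ) + 1] [(ς : ℝ), 0] [-n - j / p.ν]
    (p.Θ γ * h ^ p.ν / calP p Pth γ C)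

/-- The bracket of eight Meijer terms. -/
def bracket (p : Params) (Pth γ C : ℝ) (n : ℕ) (ς : ℤ) : ℝ :=
  let c := Real.cos p.φ
  let G := gTerm p Pth γ C n ς
  p.h2 ^ (p.ν * n + 3) * G 3 p.h2
    - p.h1 ^ (p.ν * n + 3) * G 3 p.h1
    - p.h1 * (p.h1 / c) ^ (p.ν * n + 2) * G 2 (p.h1 / c)
    + p.h1 ^ (p.ν * n + 3) * G 2 p.h1
    - c * (p.h2 / c) ^ (p.ν * n + 3) * G 3 (p.h2 / c)
    + c * (p.h1 / c) ^ (p.ν * n + 3) * G 3 (p.h1 / c)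
    + p.h2 * (p.h2 / c) ^ (p.ν * n + 2) * G 2 (p.h2 / c)
    - p.h2 ^ (p.ν * n + 3) * G 2 p.h2

/-- The term of the innermost series (over `k₂`), with `ς₁ = 1 + k₁ + k₂ - n`. -/
def innerTerm (p : Params) (Pth γ C : ℝ) (k n k₁ k₂ : ℕ) : ℝ :=
  let ς₁ : ℤ := 1 + k₁ + k₂ - n
  (-1) ^ k₂ / (Nat.factorial k₂ : ℝ) * (calP p Pth γ C ^ ς₁ / p.calD γ ^ (k₁ + k₂ + 2)) *
    deltaGamma (k + k₂ + 2) (p.βbar * p.calD γ * p.wmin ^ 2 / C)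
      (p.βbar * p.calD γ * p.wmax ^ 2 / C) *
    bracket p Pth γ C n ς₁

/-- The term of the outer series (over `m`). -/
def outerTerm (p : Params) (Pth γ C : ℝ) (k m : ℕ) : ℝ :=
  ∑ n ∈ Finset.range (m + 1),
    p.K ^ m * p.Θ γ ^ n / ((Nat.factorial m : ℝ) * (Nat.factorial n : ℝ)) *
      ∑ k₁ ∈ Finset.range (k + 1), (Nat.choose k k₁ : ℝ) *
        ∑' k₂ : ℕ, innerTerm p Pth γ C k n k₁ k₂

/-- The series `Ψ₁` as a function of the coefficient `C`. -/
def Psi1 (p : Params) (Pth γ C : ℝ) : ℝ :=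
  3 * C * p.αsr /
      (p.wer * p.wmin * p.ν * (p.h2 ^ 3 - p.h1 ^ 3) * Real.tan p.φ ^ 2) *
    ∑ k ∈ Finset.range p.msr, p.ζ k * Real.exp (-p.K) / p.βbar ^ (k + 2) *
      ∑' m : ℕ, outerTerm p Pth γ C k m

/-- All the infinite series in `Psi1` converge (absolutely). -/
def Psi1Converges (p : Params) (Pth γ C : ℝ) : Prop :=
  ∀ k < p.msr,
    (∀ n : ℕ, ∀ k₁ ≤ k, Summable fun k₂ : ℕ => innerTerm p Pth γ C k n k₁ k₂) ∧
    Summable fun m : ℕ => outerTerm p Pth γ C k m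

/-- `Ψ̄₁`: the series for perfect interference cancellation, with `C = ℰ`. -/
def PsiBar1 (p : Params) (Pth γ : ℝ) : ℝ := Psi1 p Pth γ p.calE

end A2A

end

noncomputable section

namespace A2A


/-! ### The Meijer function as a double integral -/

/-! Put `w = |S|²`, `v = |T|` and `z = ℰ|g_sr|²/w - 𝒟`. Clearing the denominator of the SNR turns `Λ
> γ` into `z |g_rt|² v^(-ν) > σ_t² γ`. This forces `z > 0`, and the power constraint is `z ≤ 𝒫`.
Hence the event is empty when `𝒫 ≤ 0`. Otherwise its probability is an integral over `(w, z, v)`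
with `0 < z ≤ 𝒫`, whose integrand is the density of `z` given `w` times the Rician tail at `σ_t² γ
v^ν / z` (`P5_eq_integral`). By Archimedes' hat-box theorem `w` is uniform on an interval, and at
fixed depth the distance `v` has a density proportional to `v` on an interval.

The series is this integral expanded (`psi1_eq_integral`). The Rician tail is a Poisson mixture of
Erlang tails (sums over `m` and `n`), `(z+𝒟)^k` is expanded by the binomial theorem (`k₁`), and
`e^(-β̄zw/ℰ)` as a power series (`k₂`). In each resulting term the `w`-integral splits off and is a
difference of incomplete Gamma functions. The `z`-integral is a generalized exponential integral,
and its integral over the cone is the bracket of eight Meijer terms (`bracket_eq`). The last fact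
rests on a representation of the Meijer function as a double integral over the unit square, obtained
by Mellin inversion (`meijerG_eq_squareIntegral`). Sums and integrals commute because `w` and `z`
range over bounded intervals and `xⁿe^(-x) ≤ n!`, so that constants dominate.

At the boundary `𝒫 = 0` the probability is zero, and it is right-continuous in the threshold power,
so the series has limit zero. -/

lemma exp_neg_le_rpow {σ y : ℝ} (hσ : 0 < σ) (hy : 0 < y) :
    Real.exp (-y) ≤ σ ^ σ * y ^ (-σ) := by
  have h1 : y ≤ σ * Real.exp (y / σ) := by
    have := Real.add_one_le_exp (y / σ)
    have h2 : y / σ ≤ Real.exp (y / σ) := by linarith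
    rwa [div_le_iff₀' hσ] at h2
  have h3 : y ^ σ ≤ σ ^ σ * Real.exp y := by
    calc y ^ σ ≤ (σ * Real.exp (y / σ)) ^ σ := Real.rpow_le_rpow hy.le h1 hσ.le
      _ = σ ^ σ * Real.exp y := by
        rw [Real.mul_rpow hσ.le (Real.exp_pos _).le, ← Real.exp_mul, div_mul_cancel₀ _ hσ.ne']
  rw [Real.exp_neg, Real.rpow_neg hy.le, ← div_eq_mul_inv, inv_eq_one_div,
    div_le_div_iff₀ (Real.exp_pos _) (Real.rpow_pos_of_pos hy _)]
  linarith

lemma integrableOn_Ioc_rpow {r : ℝ} (hr : -1 < r) :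
    Integrable (fun t : ℝ => t ^ r) (volume.restrict (Set.Ioc 0 1)) := by
  have := intervalIntegral.intervalIntegrable_rpow' (a := 0) (b := 1) hr
  rwa [intervalIntegrable_iff_integrableOn_Ioc_of_le zero_le_one] at this

lemma integral_Ioc_cpow {w : ℂ} (hw : -1 < w.re) :
    ∫ t : ℝ in Set.Ioc 0 1, (t : ℂ) ^ w = 1 / (w + 1) := by
  rw [← intervalIntegral.integral_of_le zero_le_one, integral_cpow (Or.inl hw)]
  have h : w + 1 ≠ 0 := by
    intro h
    have := congrArg Complex.re h
    simp at this
    linarith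
  simp [Complex.zero_cpow h]

/-- Lebesgue measure on the half-open unit square. -/
abbrev unitSquare : Measure (ℝ × ℝ) :=
  (volume.restrict (Set.Ioc (0 : ℝ) 1)).prod (volume.restrict (Set.Ioc (0 : ℝ) 1))

lemma ae_unitSquare : ∀ᵐ z ∂unitSquare, (0 < z.1 ∧ z.1 ≤ 1) ∧ 0 < z.2 ∧ z.2 ≤ 1 := by
  rw [unitSquare, Measure.prod_restrict]
  filter_upwards [ae_restrict_mem (measurableSet_Ioc.prod measurableSet_Ioc)] with z hz
  exact ⟨hz.1, hz.2⟩

/-- The integrand of the double integral that represents the Meijer function. -/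
def squareKernel (ς A q : ℝ) (z : ℝ × ℝ) : ℝ :=
  z.1 ^ (ς - 1) * z.2 ^ (A - 1) * Real.exp (-(z.2 / z.1 * q))

lemma measurable_squareKernel (ς A : ℝ) :
    Measurable fun x : ℝ × (ℝ × ℝ) => squareKernel ς A x.1 x.2 := by
  unfold squareKernel
  fun_prop

lemma squareKernel_nonneg {ς A q : ℝ} {z : ℝ × ℝ} (h1 : 0 < z.1) (h2 : 0 < z.2) :
    0 ≤ squareKernel ς A q z := by
  unfold squareKernel
  positivity

lemma integrable_squareKernel {ς A q : ℝ} (hA : 0 < A) (hςA : 0 < A + ς) (hq : 0 < q) :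
    Integrable (squareKernel ς A q) unitSquare := by
  -- Replacing `e^(-y)` by a multiple of `y^(-σ)` separates the variables. The two powers are
  -- integrable at `0` when `-ς < σ` and `σ < A`, and the bound needs `σ > 0`.
  obtain ⟨σ, hσ1, hσA⟩ := exists_between (max_lt hA (by linarith : -ς < A))
  have hσ : 0 < σ := lt_of_le_of_lt (le_max_left _ _) hσ1
  have hσς : -ς < σ := lt_of_le_of_lt (le_max_right _ _) hσ1
  have hb : Integrable (fun z : ℝ × ℝ => (σ ^ σ * q ^ (-σ)) *
      (z.1 ^ (ς - 1 + σ) * z.2 ^ (A - 1 - σ))) unitSquare :=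
    ((integrableOn_Ioc_rpow (by linarith)).mul_prod
      (integrableOn_Ioc_rpow (by linarith))).const_mul _
  refine hb.mono' ((measurable_squareKernel ς A).comp (measurable_prodMk_left
    (x := q))).aestronglyMeasurable ?_
  filter_upwards [ae_unitSquare] with z hz
  obtain ⟨⟨h1, -⟩, h2, -⟩ := hz
  rw [Real.norm_of_nonneg (squareKernel_nonneg h1 h2)]
  have h3 := exp_neg_le_rpow hσ (y := z.2 / z.1 * q) (by positivity)
  have h4 : (z.2 / z.1 * q) ^ (-σ) = q ^ (-σ) * (z.1 ^ σ * z.2 ^ (-σ)) := by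
    rw [Real.mul_rpow (by positivity) hq.le, Real.div_rpow h2.le h1.le,
      Real.rpow_neg h1.le σ, div_inv_eq_mul]
    ring
  unfold squareKernel
  calc z.1 ^ (ς - 1) * z.2 ^ (A - 1) * Real.exp (-(z.2 / z.1 * q))
      ≤ z.1 ^ (ς - 1) * z.2 ^ (A - 1) * (σ ^ σ * (z.2 / z.1 * q) ^ (-σ)) := by gcongr
    _ = _ := by
      rw [h4, Real.rpow_add h1, sub_eq_add_neg (A - 1) σ, Real.rpow_add h2]
      ring

/-- The double integral that represents the Meijer function. -/
def squareIntegral (ς A q : ℝ) : ℝ := ∫ z, squareKernel ς A q z ∂unitSquare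

lemma continuousAt_squareIntegral {ς A q : ℝ} (hA : 0 < A) (hςA : 0 < A + ς) (hq : 0 < q) :
    ContinuousAt (squareIntegral ς A) q := by
  refine continuousAt_of_dominated (bound := squareKernel ς A (q / 2)) ?_ ?_
    (integrable_squareKernel hA hςA (half_pos hq)) ?_
  · exact Eventually.of_forall fun r => ((measurable_squareKernel ς A).comp (measurable_prodMk_left
      (x := r))).aestronglyMeasurable
  · filter_upwards [lt_mem_nhds (half_lt_self hq)] with r hr
    filter_upwards [ae_unitSquare] with z hz
    obtain ⟨⟨h1, -⟩, h2, -⟩ := hz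
    rw [Real.norm_of_nonneg (squareKernel_nonneg h1 h2)]
    unfold squareKernel
    gcongr
  · filter_upwards with z
    unfold squareKernel
    fun_prop

/-- Fubini: integrating over `q` first gives `Γ(s)(t/u)^s`, and the powers of `t` and `u` then
integrate separately. Each of the three conditions on `s.re` makes one of these integrals converge.
-/
lemma hasMellin_squareIntegral {ς A : ℝ} {s : ℂ} (h0 : 0 < s.re) (hς : -ς < s.re)
    (hA : s.re < A) :
    HasMellin (fun q => (squareIntegral ς A q : ℂ)) s
      (Complex.Gamma s * (1 / (ς + s)) * (1 / (A - s))) := by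
  have hker : ∀ z : ℝ × ℝ, 0 < z.1 → 0 < z.2 → ∀ q ∈ Set.Ioi (0 : ℝ),
      ‖(q : ℂ) ^ (s - 1) * (squareKernel ς A q z : ℂ)‖ =
        z.1 ^ (ς - 1) * z.2 ^ (A - 1) *
          (q ^ (s.re - 1) * Real.exp (-(z.2 / z.1 * q))) := by
    intro z h1 h2 q hq
    rw [norm_mul, Complex.norm_cpow_eq_rpow_re_of_pos hq, Complex.norm_real,
      Real.norm_of_nonneg (squareKernel_nonneg h1 h2)]
    simp only [Complex.sub_re, Complex.one_re, squareKernel]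
    ring
  have hexp : ∀ r : ℝ, 0 < r → IntegrableOn
      (fun q : ℝ => q ^ (s.re - 1) * Real.exp (-(r * q))) (Set.Ioi 0) := by
    intro r hr
    have := integrableOn_rpow_mul_exp_neg_mul_rpow (s := s.re - 1) (p := 1) (b := r)
      (by linarith) one_pos hr
    simpa using this
  have hmeas : Measurable fun x : ℝ × (ℝ × ℝ) =>
      (x.1 : ℂ) ^ (s - 1) * (squareKernel ς A x.1 x.2 : ℂ) := by
    have := measurable_squareKernel ς A
    fun_prop
  have hint : Integrable (fun x : ℝ × (ℝ × ℝ) =>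
      (x.1 : ℂ) ^ (s - 1) * (squareKernel ς A x.1 x.2 : ℂ))
      ((volume.restrict (Set.Ioi (0 : ℝ))).prod unitSquare) := by
    rw [integrable_prod_iff' hmeas.aestronglyMeasurable]
    constructor
    · filter_upwards [ae_unitSquare] with z hz
      obtain ⟨⟨h1, -⟩, h2, -⟩ := hz
      refine (integrable_norm_iff (hmeas.comp
        measurable_prodMk_right).aestronglyMeasurable).1 ?_
      refine IntegrableOn.congr_fun ?_ (fun q hq => (hker z h1 h2 q hq).symm) measurableSet_Ioi
      exact (hexp _ (by positivity)).const_mul _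
    · have hb : Integrable (fun z : ℝ × ℝ => Real.Gamma s.re *
          (z.1 ^ (ς - 1 + s.re) * z.2 ^ (A - 1 - s.re))) unitSquare :=
        ((integrableOn_Ioc_rpow (by linarith)).mul_prod
          (integrableOn_Ioc_rpow (by linarith))).const_mul _
      refine hb.congr ?_
      filter_upwards [ae_unitSquare] with z hz
      obtain ⟨⟨h1, -⟩, h2, -⟩ := hz
      rw [setIntegral_congr_fun measurableSet_Ioi (hker z h1 h2), integral_const_mul,
        Real.integral_rpow_mul_exp_neg_mul_Ioi h0 (by positivity), one_div_div,
        Real.div_rpow h1.le h2.le, Real.rpow_add h1, Real.rpow_sub h2 (A - 1)]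
      ring
  have hswap : ∀ q : ℝ, (q : ℂ) ^ (s - 1) • (squareIntegral ς A q : ℂ) =
      ∫ z, (q : ℂ) ^ (s - 1) * (squareKernel ς A q z : ℂ) ∂unitSquare := by
    intro q
    rw [squareIntegral, smul_eq_mul, ← integral_complex_ofReal, integral_const_mul]
  constructor
  · unfold MellinConvergent
    simp only [hswap]
    exact hint.integral_prod_left
  · unfold mellin
    simp only [hswap]
    rw [integral_integral_swap hint]
    have hval : ∀ᵐ z ∂unitSquare,
        ∫ q : ℝ in Set.Ioi 0, (q : ℂ) ^ (s - 1) * (squareKernel ς A q z : ℂ) =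
          Complex.Gamma s * ((z.1 : ℂ) ^ (ς - 1 + s) * (z.2 : ℂ) ^ (A - 1 - s)) := by
      filter_upwards [ae_unitSquare] with z hz
      obtain ⟨⟨h1, -⟩, h2, -⟩ := hz
      have e : ∀ q : ℝ, (q : ℂ) ^ (s - 1) * (squareKernel ς A q z : ℂ) =
          ((z.1 : ℂ) ^ ((ς : ℂ) - 1) * (z.2 : ℂ) ^ ((A : ℂ) - 1)) *
            ((q : ℂ) ^ (s - 1) * Complex.exp (-(((z.2 / z.1 : ℝ) : ℂ) * q))) := by
        intro q
        unfold squareKernel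
        push_cast [Complex.ofReal_cpow h1.le, Complex.ofReal_cpow h2.le]
        ring
      simp only [e]
      rw [integral_const_mul, Complex.integral_cpow_mul_exp_neg_mul_Ioi h0
        (by have := div_pos h2 h1; exact_mod_cast this)]
      have h1' : (z.1 : ℂ) ≠ 0 := by exact_mod_cast h1.ne'
      have h2' : (z.2 : ℂ) ≠ 0 := by exact_mod_cast h2.ne'
      have e2 : (1 / ((z.2 / z.1 : ℝ) : ℂ)) ^ s = (z.1 : ℂ) ^ s / (z.2 : ℂ) ^ s := by
        rw [← Complex.ofReal_one, ← Complex.ofReal_div, one_div_div, Complex.ofReal_div,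
          div_eq_mul_inv, ← Complex.ofReal_inv, Complex.mul_cpow_ofReal_nonneg h1.le
          (by positivity), Complex.ofReal_inv, Complex.inv_cpow _ _ (by
            rw [Complex.arg_ofReal_of_nonneg h2.le]; exact Real.pi_pos.ne), div_eq_mul_inv]
      rw [e2, Complex.cpow_add _ _ h1', Complex.cpow_sub ((A : ℂ) - 1) s h2']
      ring
    rw [integral_congr_ae hval, integral_const_mul,
      integral_prod_mul (fun t : ℝ => (t : ℂ) ^ ((ς : ℂ) - 1 + s))
        (fun t : ℝ => (t : ℂ) ^ ((A : ℂ) - 1 - s)),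
      integral_Ioc_cpow (by simp; linarith), integral_Ioc_cpow (by simp; linarith)]
    ring_nf

lemma integrable_inv_sq_add_sq {a : ℝ} (ha : a ≠ 0) :
    Integrable fun y : ℝ => (a ^ 2 + y ^ 2)⁻¹ := by
  have h := (integrable_inv_one_add_sq.comp_div ha).const_mul ((a ^ 2)⁻¹)
  refine h.congr (Eventually.of_forall fun y => ?_)
  change (a ^ 2)⁻¹ * (1 + (y / a) ^ 2)⁻¹ = (a ^ 2 + y ^ 2)⁻¹
  rw [← mul_inv]
  congr 1
  field_simp

lemma norm_Gamma_le {s : ℂ} (hs : 0 < s.re) : ‖Complex.Gamma s‖ ≤ Real.Gamma s.re := by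
  rw [Complex.Gamma_eq_integral hs, Real.Gamma_eq_integral hs, Complex.GammaIntegral]
  refine (norm_integral_le_integral_norm _).trans_eq ?_
  refine setIntegral_congr_fun measurableSet_Ioi fun x hx => ?_
  rw [norm_mul, Complex.norm_cpow_eq_rpow_re_of_pos hx, Complex.norm_real,
    Real.norm_of_nonneg (Real.exp_pos _).le, Complex.sub_re, Complex.one_re]

/-- No decay of `Γ` is needed: on the line it is bounded by `Γ(σ)`, and the two linear denominators
together decay quadratically. -/
lemma verticalIntegrable_gamma_mul {a b σ : ℝ} (hσ : 0 < σ) (ha : 0 < a + σ) (hb : σ < b) :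
    Complex.VerticalIntegrable
      (fun s => Complex.Gamma s * (1 / (a + s)) * (1 / (b - s))) σ := by
  have hA : ∀ y : ℝ, (a : ℂ) + (σ + y * Complex.I) ≠ 0 := fun y h => by
    have := congrArg Complex.re h
    simp at this
    linarith
  have hB : ∀ y : ℝ, (b : ℂ) - (σ + y * Complex.I) ≠ 0 := fun y h => by
    have := congrArg Complex.re h
    simp at this
    linarith
  have hbd := (((integrable_inv_sq_add_sq ha.ne').add
    (integrable_inv_sq_add_sq (sub_pos.2 hb).ne')).const_mul (Real.Gamma σ))
  refine hbd.mono' ?_ (Eventually.of_forall fun y => ?_)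
  · refine Continuous.aestronglyMeasurable ?_
    have hG : Continuous fun y : ℝ => Complex.Gamma (σ + y * Complex.I) := by
      rw [continuous_iff_continuousAt]
      intro y
      refine ContinuousAt.comp (f := fun y : ℝ => (σ : ℂ) + y * Complex.I)
        (Complex.differentiableAt_Gamma _ fun m h => ?_).continuousAt (by fun_prop)
      have := congrArg Complex.re h
      simp at this
      have hm : (0 : ℝ) ≤ m := m.cast_nonneg
      linarith
    exact (hG.mul (continuous_const.div (by fun_prop) hA)).mul
      (continuous_const.div (by fun_prop) hB)
  · have hn1 : ‖(a : ℂ) + (σ + y * Complex.I)‖ ^ 2 = (a + σ) ^ 2 + y ^ 2 := by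
      rw [Complex.sq_norm, Complex.normSq_apply]; simp; ring
    have hn2 : ‖(b : ℂ) - (σ + y * Complex.I)‖ ^ 2 = (b - σ) ^ 2 + y ^ 2 := by
      rw [Complex.sq_norm, Complex.normSq_apply]; simp; ring
    have hg := norm_Gamma_le (s := σ + y * Complex.I) (by simpa using hσ)
    simp only [Complex.add_re, Complex.ofReal_re, Complex.mul_re, Complex.I_re, mul_zero,
      Complex.ofReal_im, Complex.I_im, mul_one, sub_self, add_zero] at hg
    rw [norm_mul, norm_mul, norm_div, norm_div, norm_one, mul_assoc]
    simp only [Pi.add_apply]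
    rw [← hn1, ← hn2]
    refine mul_le_mul hg ?_ (by positivity) (Real.Gamma_pos_of_pos hσ).le
    rw [← inv_pow, ← inv_pow, one_div, one_div]
    nlinarith [sq_nonneg (‖(a : ℂ) + (σ + y * Complex.I)‖⁻¹ - ‖(b : ℂ) - (σ + y * Complex.I)‖⁻¹),
      sq_nonneg (‖(a : ℂ) + (σ + y * Complex.I)‖⁻¹), sq_nonneg (‖(b : ℂ) - (σ + y * Complex.I)‖⁻¹)]

/-- The Meijer function `G^{2,1}_{2,3}[x | 1-A, ς+1 ; ς, 0, -A]` as a double integral. -/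
theorem meijerG_eq_squareIntegral {ς A x : ℝ} (hA : 0 < A) (hςA : 0 < A + ς) (hx : 0 < x) :
    meijerG [1 - A] [ς + 1] [ς, 0] [-A] x = squareIntegral ς A x := by
  have hex : ∃ c : ℝ, IsSeparating [1 - A] [ς, 0] c := by
    obtain ⟨c, h1, h2⟩ := exists_between (lt_min (by linarith : -A < ς) (by linarith : -A < 0))
    refine ⟨c, by simpa using h1, ?_⟩
    simpa using ⟨h2.trans_le (min_le_left _ _), h2.trans_le (min_le_right _ _)⟩
  rw [meijerG, dif_pos hex]
  obtain ⟨h1, h2⟩ := hex.choose_spec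
  set c := hex.choose
  have hc1 : -A < c := by simpa using h1
  have hc2 : c < ς := by simpa using h2 ς (by simp)
  have hc3 : c < 0 := by simpa using h2 0 (by simp)
  set M : ℂ → ℂ := fun s => Complex.Gamma s * (1 / (ς + s)) * (1 / (A - s)) with hM
  have hmel : ∀ s : ℂ, s.re = -c →
      HasMellin (fun q => (squareIntegral ς A q : ℂ)) s (M s) := fun s hs =>
    hasMellin_squareIntegral (by rw [hs]; linarith) (by rw [hs]; linarith) (by rw [hs]; linarith)
  have hre : ∀ y : ℝ, (((-c : ℝ) : ℂ) + y * Complex.I).re = -c := fun y => by simp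
  have hline : ∀ y : ℝ, mellin (fun q => (squareIntegral ς A q : ℂ)) ((-c : ℝ) + y * Complex.I) =
      M ((-c : ℝ) + y * Complex.I) := fun y => (hmel _ (hre y)).2
  -- Since `-A < c < min ς 0`, the line `Re s = -c` lies in the strip of convergence `max 0 (-ς) <
  -- Re s < A`.
  have hinv := mellinInv_mellin_eq (-c) (fun q => (squareIntegral ς A q : ℂ)) hx
    (hmel _ (by simp)).1 (by
      unfold Complex.VerticalIntegrable
      simp only [hline]
      exact verticalIntegrable_gamma_mul (by linarith) (by linarith) (by linarith))
    (Complex.continuous_ofReal.continuousAt.comp (continuousAt_squareIntegral hA hςA hx))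
  unfold mellinInv at hinv
  simp only [hline] at hinv
  have hint : ∀ t : ℝ, meijerIntegrand [1 - A] [ς + 1] [ς, 0] [-A] x ((c : ℂ) + t * Complex.I) =
      (x : ℂ) ^ (-(((-c : ℝ) : ℂ) + ((-t : ℝ) : ℂ) * Complex.I)) •
        M ((-c : ℝ) + ((-t : ℝ) : ℂ) * Complex.I) := by
    intro t
    have e1 : -(((-c : ℝ) : ℂ) + ((-t : ℝ) : ℂ) * Complex.I) = (c : ℂ) + t * Complex.I := by
      push_cast; ring
    have e2 : (((-c : ℝ) : ℂ) + ((-t : ℝ) : ℂ) * Complex.I) = -((c : ℂ) + t * Complex.I) := by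
      push_cast; ring
    rw [e1, e2]
    set s : ℂ := (c : ℂ) + t * Complex.I with hs
    have hsre : s.re = c := by simp [hs]
    -- Four of the five Gamma factors cancel in pairs by the functional equation, leaving `Γ(-s) /
    -- ((ς-s)(A+s))`, the Mellin transform at `-s`.
    have g1 : Complex.Gamma (ς + 1 - s) = (ς - s) * Complex.Gamma (ς - s) := by
      rw [← Complex.Gamma_add_one]
      · ring_nf
      · intro h
        have := congrArg Complex.re h
        simp [hsre] at this
        linarith
    have g2 : Complex.Gamma (1 + A + s) = (A + s) * Complex.Gamma (A + s) := by
      rw [← Complex.Gamma_add_one]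
      · ring_nf
      · intro h
        have := congrArg Complex.re h
        simp [hsre] at this
        linarith
    have n1 : Complex.Gamma (ς - s) ≠ 0 :=
      Complex.Gamma_ne_zero_of_re_pos (by simp [hsre]; linarith)
    have n2 : Complex.Gamma (A + s) ≠ 0 :=
      Complex.Gamma_ne_zero_of_re_pos (by simp [hsre]; linarith)
    simp only [meijerIntegrand, bind_pure_comp, List.map_eq_map, List.map_cons, List.map_nil,
      List.prod_cons, List.prod_nil, hM, smul_eq_mul, mul_one]
    push_cast
    rw [show (1 : ℂ) - (1 - A) + s = A + s by ring, show (1 : ℂ) - -A + s = 1 + A + s by ring,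
      g1, g2, zero_sub, ← sub_eq_add_neg, sub_neg_eq_add]
    field_simp
  simp only [hint]
  rw [integral_neg_eq_self (fun t : ℝ => (x : ℂ) ^ (-(((-c : ℝ) : ℂ) + (t : ℂ) * Complex.I)) •
        M ((-c : ℝ) + (t : ℂ) * Complex.I)) volume]
  rw [← Complex.ofReal_re (squareIntegral ς A x), ← hinv, Complex.real_smul]
  push_cast
  rfl


/-! ### The bracket of Meijer terms as an integral over the cone -/

/-- The integral `∫₀¹ t^(ς-1) e^(-q/t) dt`, a generalized exponential integral. -/
def expInt (ς q : ℝ) : ℝ :=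
  ∫ t in Set.Ioc (0 : ℝ) 1, t ^ (ς - 1) * Real.exp (-(q / t))

lemma expInt_nonneg (ς q : ℝ) : 0 ≤ expInt ς q :=
  setIntegral_nonneg measurableSet_Ioc fun _ ht =>
    mul_nonneg (Real.rpow_nonneg ht.1.le _) (Real.exp_pos _).le

lemma integrableOn_rpow_mul_exp_neg_div (ς : ℝ) {q : ℝ} (hq : 0 < q) :
    Integrable (fun t : ℝ => t ^ (ς - 1) * Real.exp (-(q / t)))
      (volume.restrict (Set.Ioc 0 1)) := by
  have hσ : 0 < |ς| + 1 := by positivity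
  refine ((integrableOn_Ioc_rpow (r := ς - 1 + (|ς| + 1))
    (by linarith [neg_abs_le ς])).const_mul ((|ς| + 1) ^ (|ς| + 1) * q ^ (-(|ς| + 1)))).mono'
    (by fun_prop) ?_
  filter_upwards [ae_restrict_mem measurableSet_Ioc] with t ht
  have h1 : 0 < t := ht.1
  rw [Real.norm_of_nonneg (by positivity)]
  have h2 := exp_neg_le_rpow hσ (div_pos hq h1)
  calc t ^ (ς - 1) * Real.exp (-(q / t))
      ≤ t ^ (ς - 1) * ((|ς| + 1) ^ (|ς| + 1) * (q / t) ^ (-(|ς| + 1))) := by gcongr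
    _ = _ := by
      rw [Real.rpow_add h1, Real.div_rpow hq.le h1.le, Real.rpow_neg h1.le, div_inv_eq_mul]
      ring

lemma continuousOn_expInt (ς : ℝ) : ContinuousOn (expInt ς) (Set.Ioi 0) := by
  intro q hq
  have hq : 0 < q := hq
  refine ContinuousAt.continuousWithinAt ?_
  refine continuousAt_of_dominated
    (bound := fun t : ℝ => t ^ (ς - 1) * Real.exp (-(q / 2 / t))) ?_ ?_
    (integrableOn_rpow_mul_exp_neg_div ς (half_pos hq)) ?_
  · exact Eventually.of_forall fun r => by fun_prop
  · filter_upwards [lt_mem_nhds (half_lt_self hq)] with r hr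
    filter_upwards [ae_restrict_mem measurableSet_Ioc] with t ht
    have h1 : 0 < t := ht.1
    rw [Real.norm_of_nonneg (by positivity)]
    gcongr
  · filter_upwards with t
    fun_prop

lemma integrableOn_rpow_mul_expInt {ς A x : ℝ} (hA : 0 < A) (hςA : 0 < A + ς) (hx : 0 < x) :
    IntegrableOn (fun u : ℝ => u ^ (A - 1) * expInt ς (x * u)) (Set.Ioc 0 1) ∧
      squareIntegral ς A x = ∫ u in Set.Ioc (0 : ℝ) 1, u ^ (A - 1) * expInt ς (x * u) := by
  have h := integrable_squareKernel hA hςA hx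
  have e : (fun u : ℝ => u ^ (A - 1) * expInt ς (x * u)) =
      fun u : ℝ => ∫ t in Set.Ioc (0 : ℝ) 1, squareKernel ς A x (t, u) := by
    funext u
    rw [expInt, ← integral_const_mul]
    refine integral_congr_ae (Eventually.of_forall fun t => ?_)
    simp only [squareKernel]
    rw [show u / t * x = x * u / t by ring]
    ring
  rw [e]
  exact ⟨h.integral_prod_right, integral_prod_symm _ h⟩

/-- The substitution `u = (v/h)^ν`, made in two stages. With `A = n + j/ν` and `j = 2, 3` it shows
each Meijer term, with its power of `h`, to be a primitive evaluated at `h`. -/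
lemma integral_rpow_mul_expInt {ς A X ν h : ℝ} (hA : 0 < A) (hςA : 0 < A + ς) (hX : 0 < X)
    (hν : 0 < ν) (hh : 0 < h) :
    IntervalIntegrable (fun v : ℝ => v ^ (ν * A - 1) * expInt ς (X * v ^ ν)) volume 0 h ∧
      h ^ (ν * A) * squareIntegral ς A (X * h ^ ν) =
        ν * ∫ v in (0 : ℝ)..h, v ^ (ν * A - 1) * expInt ς (X * v ^ ν) := by
  have hB : 0 < h ^ ν := Real.rpow_pos_of_pos hh _
  set B := h ^ ν with hBdef
  obtain ⟨hi, he⟩ := integrableOn_rpow_mul_expInt hA hςA (mul_pos hX hB)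
  -- scaling by `B`
  set f : ℝ → ℝ := fun w => w ^ (A - 1) * expInt ς (X * w) with hf
  have hscale : ∀ u ∈ Set.Ioc (0 : ℝ) 1,
      u ^ (A - 1) * expInt ς (X * B * u) = B ^ (1 - A) * f (B * u) := by
    intro u hu
    simp only [hf]
    rw [Real.mul_rpow hB.le hu.1.le, ← mul_assoc, ← mul_assoc, ← Real.rpow_add hB, mul_assoc X]
    simp
  have hi1 : IntervalIntegrable (fun u => f (B * u)) volume 0 1 := by
    rw [intervalIntegrable_iff_integrableOn_Ioc_of_le zero_le_one]
    refine IntegrableOn.congr_fun (hi.const_mul (B ^ (A - 1))) (fun u hu => ?_) measurableSet_Ioc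
    rw [hscale u hu, ← mul_assoc, ← Real.rpow_add hB]
    simp
  have hi2 : IntervalIntegrable f volume 0 B := by
    have := hi1.comp_mul_left (c := B⁻¹)
    simpa [hB.ne', ← mul_assoc] using this
  have he2 : squareIntegral ς A (X * B) = B ^ (-A) * ∫ w in (0 : ℝ)..B, f w := by
    rw [he, setIntegral_congr_fun measurableSet_Ioc hscale, integral_const_mul,
      ← intervalIntegral.integral_of_le zero_le_one,
      intervalIntegral.integral_comp_mul_left _ hB.ne',
      smul_eq_mul, mul_zero, mul_one, ← mul_assoc, ← Real.rpow_neg_one, ← Real.rpow_add hB]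
    ring_nf
  -- the power substitution
  set g : ℝ → ℝ := (Set.Ioc 0 B).indicator f with hg
  have hpow : ∀ v ∈ Set.Ioi (0 : ℝ), (|ν| * v ^ (ν - 1)) • g (v ^ ν) =
      (Set.Ioc 0 h).indicator (fun v => ν * (v ^ (ν * A - 1) * expInt ς (X * v ^ ν))) v := by
    intro v hv
    have hv : 0 < v := hv
    have hmem : v ^ ν ∈ Set.Ioc 0 B ↔ v ∈ Set.Ioc 0 h := by
      simp [Set.mem_Ioc, hv, Real.rpow_pos_of_pos hv, hBdef, Real.rpow_le_rpow_iff hv.le hh.le hν]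
    by_cases hm : v ∈ Set.Ioc 0 h
    · rw [hg, Set.indicator_of_mem (hmem.2 hm), Set.indicator_of_mem hm, abs_of_pos hν, hf,
        smul_eq_mul]
      simp only
      rw [← Real.rpow_mul hv.le, show ν * A - 1 = (ν - 1) + ν * (A - 1) by ring,
        Real.rpow_add hv]
      ring
    · rw [hg, Set.indicator_of_notMem (mt hmem.1 hm), Set.indicator_of_notMem hm, smul_zero]
  have hgi : IntegrableOn g (Set.Ioi 0) := by
    rw [hg, integrableOn_indicator_iff measurableSet_Ioc,
      Set.inter_eq_self_of_subset_left Set.Ioc_subset_Ioi_self]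
    rwa [intervalIntegrable_iff_integrableOn_Ioc_of_le hB.le] at hi2
  have hint := (integrableOn_Ioi_comp_rpow_iff g hν.ne').2 hgi
  have hval := integral_comp_rpow_Ioi g hν.ne'
  have hint := hint.congr_fun hpow measurableSet_Ioi
  rw [setIntegral_congr_fun measurableSet_Ioi hpow, setIntegral_indicator measurableSet_Ioc,
    Set.inter_eq_self_of_subset_right Set.Ioc_subset_Ioi_self, hg,
    setIntegral_indicator measurableSet_Ioc,
    Set.inter_eq_self_of_subset_right Set.Ioc_subset_Ioi_self, integral_const_mul,
    ← intervalIntegral.integral_of_le hB.le, ← intervalIntegral.integral_of_le hh.le] at hval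
  rw [integrableOn_indicator_iff measurableSet_Ioc,
      Set.inter_eq_self_of_subset_left Set.Ioc_subset_Ioi_self] at hint
  constructor
  · rw [intervalIntegrable_iff_integrableOn_Ioc_of_le hh.le]
    exact (integrable_const_mul_iff (isUnit_iff_ne_zero.2 hν.ne') _).1 hint
  · rw [hval, he2, hBdef, ← Real.rpow_mul hh.le, ← mul_assoc, ← Real.rpow_add hh]
    simp

/-- The inner integral is `H₂(d/c) - H₂(d)`. Integration by parts gives the antiderivatives `d
H₂(d/c) - c H₃(d/c)` and `d H₂(d) - H₃(d)`, whence the eight boundary terms. -/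
lemma integral_cone_section {Φ : ℝ → ℝ} (hΦ : ContinuousOn Φ (Set.Ioi 0))
    (h2 : ∀ h, 0 < h → IntervalIntegrable (fun v => v * Φ v) volume 0 h)
    (h3 : ∀ h, 0 < h → IntervalIntegrable (fun v => v ^ 2 * Φ v) volume 0 h)
    {a b c : ℝ} (ha : 0 < a) (hab : a ≤ b) (hc : 0 < c) :
    let H₂ := fun h : ℝ => ∫ v in (0 : ℝ)..h, v * Φ v
    let H₃ := fun h : ℝ => ∫ v in (0 : ℝ)..h, v ^ 2 * Φ v
    ∫ d in a..b, ∫ r in d..(d / c), r * Φ r =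
      b * H₂ (b / c) - c * H₃ (b / c) - b * H₂ b + H₃ b -
        (a * H₂ (a / c) - c * H₃ (a / c) - a * H₂ a + H₃ a) := by
  intro H₂ H₃
  have c2 : ContinuousOn (fun v => v * Φ v) (Set.Ioi 0) := continuousOn_id.mul hΦ
  have c3 : ContinuousOn (fun v => v ^ 2 * Φ v) (Set.Ioi 0) := (continuousOn_pow 2).mul hΦ
  have dH : ∀ f : ℝ → ℝ, ContinuousOn f (Set.Ioi 0) →
      (∀ h, 0 < h → IntervalIntegrable f volume 0 h) → ∀ d, 0 < d →
      HasDerivAt (fun h => ∫ v in (0 : ℝ)..h, f v) (f d) d := by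
    intro f hf hi d hd
    exact intervalIntegral.integral_hasDerivAt_right (hi d hd)
      (hf.stronglyMeasurableAtFilter isOpen_Ioi d hd) (hf.continuousAt (Ioi_mem_nhds hd))
  have dH2 := dH _ c2 h2
  have dH3 := dH _ c3 h3
  have hpos : ∀ d ∈ Set.uIcc a b, 0 < d := fun d hd => by
    rw [Set.uIcc_of_le hab] at hd
    exact ha.trans_le hd.1
  have hinner : ∀ d ∈ Set.uIcc a b, ∫ r in d..(d / c), r * Φ r = H₂ (d / c) - H₂ d := by
    intro d hd
    exact (intervalIntegral.integral_interval_sub_left (h2 _ (div_pos (hpos d hd) hc))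
      (h2 d (hpos d hd))).symm
  rw [intervalIntegral.integral_congr hinner]
  refine intervalIntegral.integral_eq_sub_of_hasDerivAt
    (f := fun d => d * H₂ (d / c) - c * H₃ (d / c) - d * H₂ d + H₃ d) (fun d hd => ?_) ?_
  · have hd := hpos d hd
    have hdc := div_pos hd hc
    have e1 : HasDerivAt (fun d => d / c) (1 / c) d := (hasDerivAt_id d).div_const c
    have e2 := (hasDerivAt_id d).mul ((dH2 _ hdc).comp d e1)
    have e3 := ((dH3 _ hdc).comp d e1).const_mul c
    have e4 := (hasDerivAt_id d).mul (dH2 _ hd)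
    refine (((e2.sub e3).sub e4).add (dH3 _ hd)).congr_deriv ?_
    simp only [Function.comp_apply, id_eq]
    change 1 * H₂ (d / c) + _ - _ - (1 * H₂ d + _) + _ = _
    field_simp
    ring
  · refine ContinuousOn.intervalIntegrable fun d hd => ContinuousAt.continuousWithinAt ?_
    have hd := hpos d hd
    exact ((dH2 _ (div_pos hd hc)).continuousAt.comp (f := fun d => d / c) (by fun_prop)).sub
      (dH2 _ hd).continuousAt

/-- Although `ς` may be negative, `1 ≤ ς + n` ensures `A + ς > 0` for `A = n + j/ν`, so a separating
line exists. -/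
lemma gTerm_eq {p : Params} (hν : 0 < p.ν) {Pth γ C : ℝ} (hP : 0 < calP p Pth γ C)
    (hΘ : 0 < p.Θ γ) {n : ℕ} {ς : ℤ} (hς : 1 ≤ ς + n) {j h : ℝ} (hj : 0 < j) (hh : 0 < h) :
    IntervalIntegrable (fun v : ℝ => v ^ (p.ν * n + j - 1) *
        expInt ς (p.Θ γ / calP p Pth γ C * v ^ p.ν)) volume 0 h ∧
      h ^ (p.ν * n + j) * gTerm p Pth γ C n ς j h =
        p.ν * ∫ v in (0 : ℝ)..h, v ^ (p.ν * n + j - 1) *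
          expInt ς (p.Θ γ / calP p Pth γ C * v ^ p.ν) := by
  have hjν : 0 < j / p.ν := div_pos hj hν
  have hA : 0 < n + j / p.ν := by positivity
  have hςr : (1 : ℝ) ≤ ς + n := by exact_mod_cast hς
  have hAς : 0 < n + j / p.ν + ς := by linarith
  have hexp : p.ν * n + j = p.ν * (n + j / p.ν) := by field_simp
  have h := integral_rpow_mul_expInt (ς := ς) hA hAς (div_pos hΘ hP) hν hh
  rw [hexp]
  refine ⟨h.1, ?_⟩
  rw [← h.2, gTerm, ← meijerG_eq_squareIntegral hA hAς (by positivity)]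
  congr 2 <;> ring_nf

/-- The bracket of eight Meijer terms is an integral over the coverage region. -/
theorem bracket_eq {p : Params} (hν : 0 < p.ν) (h1 : 0 < p.h1) (h12 : p.h1 ≤ p.h2)
    (hc : 0 < Real.cos p.φ) {Pth γ C : ℝ} (hP : 0 < calP p Pth γ C)
    (hΘ : 0 < p.Θ γ) {n : ℕ} {ς : ℤ} (hς : 1 ≤ ς + n) :
    bracket p Pth γ C n ς = p.ν * ∫ d in p.h1..p.h2, ∫ r in d..(d / Real.cos p.φ),
      r * (r ^ (p.ν * n) * expInt ς (p.Θ γ / calP p Pth γ C * r ^ p.ν)) := by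
  have h2 : 0 < p.h2 := h1.trans_le h12
  set X := p.Θ γ / calP p Pth γ C with hX
  have hXpos : 0 < X := div_pos hΘ hP
  set Φ : ℝ → ℝ := fun r => r ^ (p.ν * n) * expInt ς (X * r ^ p.ν) with hΦ
  have hcont : ContinuousOn Φ (Set.Ioi 0) := by
    refine ContinuousOn.mul (fun r hr => ?_) ((continuousOn_expInt ς).comp (fun r hr => ?_) ?_)
    · exact (Real.continuousAt_rpow_const _ _ (Or.inl (ne_of_gt hr))).continuousWithinAt
    · exact (continuousAt_const.mul
        (Real.continuousAt_rpow_const _ _ (Or.inl (ne_of_gt hr)))).continuousWithinAt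
    · exact fun r hr => mul_pos hXpos (Real.rpow_pos_of_pos hr _)
  have e2 : ∀ h, 0 < h → Set.EqOn (fun v : ℝ => v ^ (p.ν * n + 2 - 1) * expInt ς (X * v ^ p.ν))
      (fun v => v * Φ v) (Set.uIoc 0 h) := by
    intro h hh v hv
    rw [Set.uIoc_of_le hh.le] at hv
    simp only [hΦ]
    rw [show p.ν * n + 2 - 1 = 1 + p.ν * n by ring, Real.rpow_add hv.1, Real.rpow_one]
    ring
  have e3 : ∀ h, 0 < h → Set.EqOn (fun v : ℝ => v ^ (p.ν * n + 3 - 1) * expInt ς (X * v ^ p.ν))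
      (fun v => v ^ 2 * Φ v) (Set.uIoc 0 h) := by
    intro h hh v hv
    rw [Set.uIoc_of_le hh.le] at hv
    simp only [hΦ]
    rw [show p.ν * n + 3 - 1 = 2 + p.ν * n by ring, Real.rpow_add hv.1, Real.rpow_two]
    ring
  have i2 : ∀ h, 0 < h → IntervalIntegrable (fun v => v * Φ v) volume 0 h := fun h hh =>
    (gTerm_eq hν hP hΘ hς two_pos hh).1.congr (e2 h hh)
  have i3 : ∀ h, 0 < h → IntervalIntegrable (fun v => v ^ 2 * Φ v) volume 0 h := fun h hh =>
    (gTerm_eq hν hP hΘ hς three_pos hh).1.congr (e3 h hh)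
  have g2 : ∀ h, 0 < h → h ^ (p.ν * n + 2) * gTerm p Pth γ C n ς 2 h =
      p.ν * ∫ v in (0 : ℝ)..h, v * Φ v := fun h hh => by
    rw [(gTerm_eq hν hP hΘ hς two_pos hh).2]
    congr 1
    exact intervalIntegral.integral_congr_ae (Eventually.of_forall fun v hv => e2 h hh hv)
  have g3 : ∀ h, 0 < h → h ^ (p.ν * n + 3) * gTerm p Pth γ C n ς 3 h =
      p.ν * ∫ v in (0 : ℝ)..h, v ^ 2 * Φ v := fun h hh => by
    rw [(gTerm_eq hν hP hΘ hς three_pos hh).2]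
    congr 1
    exact intervalIntegral.integral_congr_ae (Eventually.of_forall fun v hv => e3 h hh hv)
  -- Two terms of the bracket combine `G 2` with the exponent `ν n + 3`: there the factor `h` has
  -- been absorbed into the power.
  have s3 : ∀ h : ℝ, 0 < h → h ^ (p.ν * n + 3) = h * h ^ (p.ν * n + 2) := fun h hh => by
    rw [show p.ν * n + 3 = 1 + (p.ν * n + 2) by ring, Real.rpow_add hh 1, Real.rpow_one]
  have key := integral_cone_section hcont i2 i3 h1 h12 hc
  simp only [hΦ] at key
  rw [key]
  simp only [bracket]
  have t1 := g3 _ h2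
  have t2 := g3 _ h1
  have t3 := g2 _ (div_pos h1 hc)
  have t4 := g2 _ h1
  have t5 := g3 _ (div_pos h2 hc)
  have t6 := g3 _ (div_pos h1 hc)
  have t7 := g2 _ (div_pos h2 hc)
  have t8 := g2 _ h2
  have t4' : p.h1 ^ (p.ν * n + 3) * gTerm p Pth γ C n ς 2 p.h1 =
      p.h1 * (p.ν * ∫ v in (0 : ℝ)..p.h1, v * Φ v) := by rw [← t4, s3 _ h1]; ring
  have t8' : p.h2 ^ (p.ν * n + 3) * gTerm p Pth γ C n ς 2 p.h2 =
      p.h2 * (p.ν * ∫ v in (0 : ℝ)..p.h2, v * Φ v) := by rw [← t8, s3 _ h2]; ring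
  simp only [mul_assoc] at *
  rw [t1, t2, t3, t4', t5, t6, t7, t8']
  ring


/-! ### The laws of the distances -/

lemma lintegral_comp_norm_plane {g : ℝ → ENNReal} (hg : Measurable g) :
    ∫⁻ z : ℝ × ℝ, g (z.1 ^ 2 + z.2 ^ 2) =
      ENNReal.ofReal (2 * Real.pi) * ∫⁻ ρ in Set.Ioi (0 : ℝ), ENNReal.ofReal ρ * g (ρ ^ 2) := by
  rw [← lintegral_comp_polarCoord_symm, polarCoord_target, Measure.volume_eq_prod,
    setLIntegral_prod _ (by
      simp only [polarCoord_symm_apply]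
      fun_prop)]
  have h : ∀ ρ θ : ℝ, ENNReal.ofReal ρ • g ((polarCoord.symm (ρ, θ)).1 ^ 2 +
      (polarCoord.symm (ρ, θ)).2 ^ 2) = ENNReal.ofReal ρ * g (ρ ^ 2) := by
    intro ρ θ
    rw [polarCoord_symm_apply, smul_eq_mul]
    congr 2
    simp only
    rw [mul_pow, mul_pow, ← mul_add, Real.cos_sq_add_sin_sq, mul_one]
  simp only [h]
  rw [← lintegral_const_mul _ (by fun_prop)]
  refine lintegral_congr fun ρ => ?_
  rw [setLIntegral_const, Real.volume_Ioo, mul_comm]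
  ring_nf

/-- The substitution `r² = d² + ρ²` satisfies `ρ dρ = r dr`. So in a horizontal plane the distance
to the origin has density proportional to `r`, whatever the height `d`; only the range of `r`
depends on it. -/
lemma lintegral_radial_shift (d : ℝ) (F : ℝ → ENNReal) :
    ∫⁻ ρ in Set.Ioi (0 : ℝ), ENNReal.ofReal ρ * F (Real.sqrt (d ^ 2 + ρ ^ 2)) =
      ∫⁻ r in Set.Ioi |d|, ENNReal.ofReal r * F r := by
  have hpos : ∀ r ∈ Set.Ioi |d|, 0 < r ^ 2 - d ^ 2 := fun r hr => by
    have : |d| < r := hr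
    nlinarith [abs_nonneg d, sq_abs d]
  have himg : (fun r : ℝ => Real.sqrt (r ^ 2 - d ^ 2)) '' Set.Ioi |d| = Set.Ioi 0 := by
    ext ρ
    constructor
    · rintro ⟨r, hr, rfl⟩
      exact Real.sqrt_pos.2 (hpos r hr)
    · intro hρ
      have hρ : 0 < ρ := hρ
      refine ⟨Real.sqrt (d ^ 2 + ρ ^ 2), ?_, ?_⟩
      · exact Real.lt_sqrt_of_sq_lt (by rw [sq_abs]; nlinarith)
      · simp only
        rw [Real.sq_sqrt (by positivity), add_sub_cancel_left, Real.sqrt_sq hρ.le]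
  have hinj : Set.InjOn (fun r : ℝ => Real.sqrt (r ^ 2 - d ^ 2)) (Set.Ioi |d|) := by
    intro r hr r' hr' h
    have h1 : 0 < r := (abs_nonneg d).trans_lt hr
    have h2 : 0 < r' := (abs_nonneg d).trans_lt hr'
    have := (Real.sqrt_inj (hpos r hr).le (hpos r' hr').le).1 h
    exact (pow_left_inj₀ h1.le h2.le two_ne_zero).1 (by linarith)
  rw [← himg, lintegral_image_eq_lintegral_abs_deriv_mul measurableSet_Ioi
    (f' := fun r => r / Real.sqrt (r ^ 2 - d ^ 2)) (fun r hr => ?_) hinj]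
  · refine setLIntegral_congr_fun measurableSet_Ioi fun r hr => ?_
    have h0 : 0 < r := (abs_nonneg d).trans_lt hr
    have hs := Real.sqrt_pos.2 (hpos r hr)
    rw [← mul_assoc, ← ENNReal.ofReal_mul (abs_nonneg _), abs_of_pos (by positivity),
      div_mul_cancel₀ _ hs.ne', Real.sq_sqrt (hpos r hr).le, add_sub_cancel, Real.sqrt_sq h0.le]
  · have h1 : HasDerivAt (fun r : ℝ => r ^ 2 - d ^ 2) (2 * r) r := by
      simpa using (hasDerivAt_pow 2 r).sub_const (d ^ 2)
    refine ((h1.sqrt (hpos r hr).ne').congr_deriv ?_).hasDerivWithinAt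
    have hs := Real.sqrt_pos.2 (hpos r hr)
    field_simp

lemma radial_section_eq (f : ℝ × ℝ → ENNReal) (d : ℝ) :
    ∫⁻ r in Set.Ioi |d|, ENNReal.ofReal r * f (d, r) =
      ∫⁻ r, {q : ℝ × ℝ | |q.1| < q.2}.indicator (fun q => ENNReal.ofReal q.2 * f q) (d, r) := by
  rw [← lintegral_indicator measurableSet_Ioi]
  rfl

lemma measurable_radial_indicator {f : ℝ × ℝ → ENNReal} (hf : Measurable f) :
    Measurable ({q : ℝ × ℝ | |q.1| < q.2}.indicator fun q => ENNReal.ofReal q.2 * f q) :=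
  Measurable.indicator (by fun_prop) (measurableSet_lt (by fun_prop) (by fun_prop))

lemma measurable_radial_section {f : ℝ × ℝ → ENNReal} (hf : Measurable f) :
    Measurable fun d : ℝ => ∫⁻ r in Set.Ioi |d|, ENNReal.ofReal r * f (d, r) := by
  simp only [radial_section_eq]
  exact (measurable_radial_indicator hf).lintegral_prod_right'

/-- Integration over space of a function of the height and of the distance to the origin. -/
lemma lintegral_comp_height_norm {f : ℝ × ℝ → ENNReal} (hf : Measurable f) :
    ∫⁻ x : Space, f (x 2, ‖x‖) =
      ENNReal.ofReal (2 * Real.pi) * ∫⁻ d, ∫⁻ r in Set.Ioi |d|, ENNReal.ofReal r * f (d, r) := by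
  have hnorm : ∀ x : Space, ‖x‖ = Real.sqrt (x 2 ^ 2 + (x 0 ^ 2 + x 1 ^ 2)) := by
    intro x
    rw [EuclideanSpace.norm_eq, Fin.sum_univ_three]
    simp only [Real.norm_eq_abs, sq_abs]
    congr 1
    ring
  set G : ℝ × (ℝ × ℝ) → ENNReal := fun y =>
    f (y.1, Real.sqrt (y.1 ^ 2 + (y.2.1 ^ 2 + y.2.2 ^ 2))) with hG
  have hGm : Measurable G := by fun_prop
  have e1 : ∫⁻ x : Space, f (x 2, ‖x‖) = ∫⁻ y : Fin 3 → ℝ, G (y 2, (y 0, y 1)) := by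
    rw [← (PiLp.volume_preserving_toLp (Fin 3)).lintegral_comp_emb
      (MeasurableEquiv.toLp 2 (Fin 3 → ℝ)).measurableEmbedding]
    simp only [hnorm, hG]
  have e2 : ∫⁻ y : Fin 3 → ℝ, G (y 2, (y 0, y 1)) =
      ∫⁻ z : ℝ × (Fin 2 → ℝ), G (z.1, (z.2 0, z.2 1)) := by
    rw [← (volume_preserving_piFinSuccAbove (fun _ : Fin 3 => ℝ) 2).lintegral_comp_emb
      (MeasurableEquiv.measurableEmbedding _)]
    rfl
  have e3 : ∀ d : ℝ, ∫⁻ z : Fin 2 → ℝ, G (d, (z 0, z 1)) = ∫⁻ z : ℝ × ℝ, G (d, z) := by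
    intro d
    rw [← (volume_preserving_finTwoArrow ℝ).lintegral_comp_emb
      (MeasurableEquiv.measurableEmbedding _)]
    rfl
  rw [e1, e2, Measure.volume_eq_prod, lintegral_prod _ (by fun_prop)]
  simp only [e3]
  have hm := measurable_radial_section hf
  rw [← lintegral_const_mul _ hm]
  refine lintegral_congr fun d => ?_
  simp only [hG]
  rw [lintegral_comp_norm_plane (g := fun t => f (d, Real.sqrt (d ^ 2 + t))) (by fun_prop),
    lintegral_radial_shift d (fun r => f (d, r))]

/-- The volume of a spherical sector. -/
lemma volume_sector {a : ℝ} (ha : 0 ≤ a) (ha1 : a ≤ 1) :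
    volume {x : Space | 0 < ‖x‖ ∧ ‖x‖ < 1 ∧ a * ‖x‖ ≤ x 2} =
      ENNReal.ofReal (2 * Real.pi * (1 - a) / 3) := by
  set B : Set (ℝ × ℝ) := {q | 0 < q.2 ∧ q.2 < 1 ∧ a * q.2 ≤ q.1} with hB
  have hBm : MeasurableSet B :=
    (measurableSet_lt measurable_const measurable_snd).inter
      ((measurableSet_lt measurable_snd measurable_const).inter
        (measurableSet_le (by fun_prop) measurable_fst))
  have hf : Measurable (B.indicator (1 : ℝ × ℝ → ENNReal)) := measurable_one.indicator hBm
  have h2 : Measurable fun x : Space => x 2 := by fun_prop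
  have hSm : MeasurableSet {x : Space | 0 < ‖x‖ ∧ ‖x‖ < 1 ∧ a * ‖x‖ ≤ x 2} :=
    (h2.prodMk measurable_norm) hBm
  have e1 : volume {x : Space | 0 < ‖x‖ ∧ ‖x‖ < 1 ∧ a * ‖x‖ ≤ x 2} =
      ∫⁻ x : Space, B.indicator (1 : ℝ × ℝ → ENNReal) (x 2, ‖x‖) := by
    rw [← lintegral_indicator_one hSm]
    rfl
  rw [e1, lintegral_comp_height_norm hf]
  simp only [radial_section_eq]
  -- With the radius `r` fixed, the heights fill `[a r, r)`, of length `r(1-a)`.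
  rw [lintegral_lintegral_swap (f := fun d r => {q : ℝ × ℝ | |q.1| < q.2}.indicator
    (fun q => ENNReal.ofReal q.2 * B.indicator (1 : ℝ × ℝ → ENNReal) q) (d, r))
    (measurable_radial_indicator hf).aemeasurable]
  have hinner : ∀ r : ℝ, ∫⁻ d, {q : ℝ × ℝ | |q.1| < q.2}.indicator
      (fun q => ENNReal.ofReal q.2 * B.indicator (1 : ℝ × ℝ → ENNReal) q) (d, r) =
      (Set.Ioo (0 : ℝ) 1).indicator (fun r => ENNReal.ofReal (r ^ 2 * (1 - a))) r := by
    intro r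
    by_cases hr : r ∈ Set.Ioo (0 : ℝ) 1
    · rw [Set.indicator_of_mem hr]
      have : ∀ d : ℝ, {q : ℝ × ℝ | |q.1| < q.2}.indicator
          (fun q => ENNReal.ofReal q.2 * B.indicator (1 : ℝ × ℝ → ENNReal) q) (d, r) =
          (Set.Ico (a * r) r).indicator (fun _ => ENNReal.ofReal r) d := by
        intro d
        have har : 0 ≤ a * r := mul_nonneg ha hr.1.le
        by_cases hd : d ∈ Set.Ico (a * r) r
        · have h1 : (d, r) ∈ {q : ℝ × ℝ | |q.1| < q.2} := by
            simp only [Set.mem_ofPred_eq]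
            rw [abs_of_nonneg (har.trans hd.1)]
            exact hd.2
          have h2 : (d, r) ∈ B := ⟨hr.1, hr.2, hd.1⟩
          simp [Set.indicator_of_mem, h1, h2, hd]
        · rw [Set.indicator_of_notMem hd]
          by_cases h1 : (d, r) ∈ {q : ℝ × ℝ | |q.1| < q.2}
          · have h2 : (d, r) ∉ B := fun h2 => hd ⟨h2.2.2, (le_abs_self d).trans_lt h1⟩
            rw [Set.indicator_of_mem h1, Set.indicator_of_notMem h2, mul_zero]
          · rw [Set.indicator_of_notMem h1]
      simp only [this]
      rw [lintegral_indicator_const measurableSet_Ico, Real.volume_Ico,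
        ← ENNReal.ofReal_mul hr.1.le]
      congr 1
      ring
    · rw [Set.indicator_of_notMem hr]
      rw [← lintegral_zero (μ := (volume : Measure ℝ))]
      refine lintegral_congr fun d => ?_
      have h2 : (d, r) ∉ B := fun h2 => hr ⟨h2.1, h2.2.1⟩
      simp [Set.indicator_apply, h2]
  simp only [hinner]
  rw [lintegral_indicator measurableSet_Ioo, setLIntegral_congr Ioo_ae_eq_Ioc,
    ← ofReal_integral_eq_lintegral_ofReal
      (Continuous.integrableOn_Ioc (by fun_prop))
      (Eventually.of_forall fun r => mul_nonneg (sq_nonneg r) (by linarith)),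
    ← intervalIntegral.integral_of_le zero_le_one, intervalIntegral.integral_mul_const,
    integral_pow, ← ENNReal.ofReal_mul (by positivity)]
  congr 1
  norm_num
  ring

open Pointwise in
/-- Archimedes' hat-box theorem. -/
lemma toSphere_cap {a : ℝ} (ha : 0 ≤ a) :
    (volume : Measure Space).toSphere {u | a ≤ (u : Space) 2} =
      ENNReal.ofReal (2 * Real.pi * (1 - a)) := by
  have hm : MeasurableSet {u : Metric.sphere (0 : Space) 1 | a ≤ (u : Space) 2} :=
    measurableSet_le measurable_const (by fun_prop)
  rcases le_or_gt a 1 with ha1 | ha1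
  -- The surface measure of the cap is three times the volume of the solid sector over it.
  · rw [Measure.toSphere_apply' _ hm]
    have hset : Set.Ioo (0 : ℝ) 1 • ((↑) '' {u : Metric.sphere (0 : Space) 1 |
        a ≤ (u : Space) 2} : Set Space) = {x : Space | 0 < ‖x‖ ∧ ‖x‖ < 1 ∧ a * ‖x‖ ≤ x 2} := by
      ext x
      simp only [Set.mem_smul, Set.mem_image, Set.mem_ofPred_eq]
      constructor
      · rintro ⟨r, hr, _, ⟨u, hu, rfl⟩, rfl⟩
        have hn : ‖r • (u : Space)‖ = r := by
          rw [norm_smul, Real.norm_of_nonneg hr.1.le, norm_eq_of_mem_sphere, mul_one]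
        rw [hn]
        refine ⟨hr.1, hr.2, ?_⟩
        rw [PiLp.smul_apply, smul_eq_mul, mul_comm a]
        exact mul_le_mul_of_nonneg_left hu hr.1.le
      · rintro ⟨h0, h1, h2⟩
        refine ⟨‖x‖, ⟨h0, h1⟩, ‖x‖⁻¹ • x, ⟨⟨‖x‖⁻¹ • x, ?_⟩, ?_, rfl⟩, ?_⟩
        · simp [norm_smul, h0.ne']
        · rw [PiLp.smul_apply, smul_eq_mul, inv_mul_eq_div, le_div_iff₀ h0]
          exact h2
        · rw [smul_smul, mul_inv_cancel₀ h0.ne', one_smul]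
    rw [hset, volume_sector ha ha1, finrank_euclideanSpace_fin]
    rw [show ((3 : ℕ) : ENNReal) = ENNReal.ofReal 3 by simp, ← ENNReal.ofReal_mul (by norm_num)]
    congr 1
    ring
  -- Here `ENNReal.ofReal` truncates the negative value to `0`; this covers thresholds below
  -- `w_min²` in `map_norm_sq_orbitSurface`.
  · have : {u : Metric.sphere (0 : Space) 1 | a ≤ (u : Space) 2} = ∅ := by
      ext u
      simp only [Set.mem_ofPred_eq, Set.mem_empty_iff_false, iff_false, not_le]
      have h1 : ‖(u : Space) 2‖ ≤ ‖(u : Space)‖ := PiLp.norm_apply_le _ 2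
      rw [norm_eq_of_mem_sphere] at h1
      exact ((le_abs_self _).trans h1).trans_lt ha1
    rw [this, measure_empty, ENNReal.ofReal_of_nonpos]
    nlinarith [Real.pi_pos]

/-- A probability measure proportional to Lebesgue measure on an interval. -/
lemma eq_smul_restrict_of_isProbabilityMeasure {μ : Measure ℝ} [IsProbabilityMeasure μ]
    {c : ENNReal} {a b : ℝ} (hab : a < b) (h : μ = c • volume.restrict (Set.Ioc a b)) :
    μ = ENNReal.ofReal (1 / (b - a)) • volume.restrict (Set.Ioc a b) := by
  have h1 : c * ENNReal.ofReal (b - a) = 1 := by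
    rw [← measure_univ (μ := μ), h]
    simp
  rw [h, one_div, ENNReal.ofReal_inv_of_pos (sub_pos.2 hab), ← ENNReal.eq_inv_of_mul_eq_one_left h1]

/-- On the orbit sphere `‖x‖²` is an affine function of the height, and the height is uniform by the
hat-box theorem. The top of the sphere gives `w_min²` and the horizon `w_max²`. -/
lemma map_norm_sq_orbitSurface {p : Params} (hwer : 0 < p.wer) (hwmin : 0 < p.wmin) :
    ((orbitSurface p).restrict (satelliteCap p)).map (fun x => ‖x‖ ^ 2) =
      ENNReal.ofReal (2 * Real.pi / (2 * (p.wer + p.wmin) * p.wer)) •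
        volume.restrict (Set.Ioc (p.wmin ^ 2) (p.wmax ^ 2)) := by
  set R := p.wer + p.wmin with hR
  have hRpos : 0 < R := by positivity
  have hwmax : p.wmax ^ 2 = p.wmin ^ 2 + 2 * p.wer * p.wmin := by
    rw [Params.wmax, Real.sq_sqrt (by positivity)]
  have hmap : Measurable fun u : Metric.sphere (0 : Space) 1 =>
      earthCentre p + R • (u : Space) := by fun_prop
  have hd : Measurable fun x : Space => dist x (earthCentre p) := by fun_prop
  have h2 : Measurable fun x : Space => x 2 := by fun_prop
  have hcap : MeasurableSet (satelliteCap p) :=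
    (measurableSet_eq_fun hd measurable_const).inter (measurableSet_le measurable_const h2)
  have hfin : IsFiniteMeasure (orbitSurface p) := by
    unfold orbitSurface
    infer_instance
  refine Measure.ext_of_Iic _ _ fun w => ?_
  have hsq : Measurable fun x : Space => ‖x‖ ^ 2 := by fun_prop
  rw [Measure.map_apply hsq measurableSet_Iic, Measure.restrict_apply
    (hsq measurableSet_Iic), orbitSurface, Measure.map_apply hmap
    ((hsq measurableSet_Iic).inter hcap)]
  -- The two lower bounds on the height of `u` express being above the horizon and `‖x‖² ≤ w`.
  set a := max (p.wer / R) ((R ^ 2 + p.wer ^ 2 - w) / (2 * R * p.wer)) with ha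
  have hset : (fun u : Metric.sphere (0 : Space) 1 => earthCentre p + R • (u : Space)) ⁻¹'
      ((fun x => ‖x‖ ^ 2) ⁻¹' Set.Iic w ∩ satelliteCap p) =
        {u : Metric.sphere (0 : Space) 1 | a ≤ (u : Space) 2} := by
    ext u
    have hu : ‖(u : Space)‖ = 1 := norm_eq_of_mem_sphere u
    have hu2 : (u : Space) 0 ^ 2 + (u : Space) 1 ^ 2 + (u : Space) 2 ^ 2 = 1 := by
      have := congrArg (· ^ 2) hu
      simp only [EuclideanSpace.norm_sq_eq, Fin.sum_univ_three, Real.norm_eq_abs, sq_abs] at this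
      linarith
    have hdist : dist (earthCentre p + R • (u : Space)) (earthCentre p) = R := by
      rw [dist_eq_norm, add_sub_cancel_left, norm_smul, hu, mul_one, Real.norm_of_nonneg hRpos.le]
    have hx2 : (earthCentre p + R • (u : Space)) 2 = -p.wer + R * (u : Space) 2 := by
      simp [earthCentre]
    have hn : ‖earthCentre p + R • (u : Space)‖ ^ 2 =
        R ^ 2 + p.wer ^ 2 - 2 * R * p.wer * (u : Space) 2 := by
      rw [EuclideanSpace.norm_sq_eq, Fin.sum_univ_three]
      simp [earthCentre, mul_pow]
      linear_combination R ^ 2 * hu2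
    simp only [satelliteCap, Set.mem_preimage, Set.mem_inter_iff, Set.mem_Iic, Set.mem_ofPred_eq,
      hdist, hn, hx2, ha, max_le_iff]
    rw [div_le_iff₀ hRpos, div_le_iff₀ (by positivity)]
    constructor
    · rintro ⟨h1, -, h2⟩
      constructor <;> linarith
    · rintro ⟨h1, h2⟩
      exact ⟨by linarith, hR, by linarith⟩
  rw [hset, toSphere_cap (le_max_of_le_left (by positivity)), Measure.smul_apply, smul_eq_mul,
    Measure.restrict_apply measurableSet_Iic, Set.inter_comm, Set.Ioc_inter_Iic, Real.volume_Ioc,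
    ← ENNReal.ofReal_mul (by positivity)]
  congr 1
  have h1a : 1 - a = (min (p.wmax ^ 2) w - p.wmin ^ 2) / (2 * R * p.wer) := by
    rw [ha]
    rcases le_total (p.wmax ^ 2) w with h | h
    · rw [min_eq_left h, max_eq_left, hwmax, hR]
      · field_simp
        ring
      · rw [div_le_div_iff₀ (by positivity) hRpos]
        have : R ^ 2 + p.wer ^ 2 - w ≤ 2 * p.wer ^ 2 := by rw [hR]; linarith
        nlinarith
    · rw [min_eq_right h, max_eq_right, hR]
      · field_simp
        ring
      · rw [div_le_div_iff₀ hRpos (by positivity)]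
        have : 2 * p.wer ^ 2 ≤ R ^ 2 + p.wer ^ 2 - w := by rw [hR]; linarith
        nlinarith
  rw [h1a]
  field_simp

lemma measurableSet_coverageRegion (p : Params) : MeasurableSet (coverageRegion p) := by
  have h2 : Measurable fun x : Space => -x 2 := by fun_prop
  have hn : Measurable fun x : Space => ‖x‖ * Real.cos p.φ := by fun_prop
  exact (measurableSet_le measurable_const h2).inter
    ((measurableSet_le h2 measurable_const).inter (measurableSet_le hn h2))

lemma setLIntegral_coverageRegion {p : Params} (h1 : 0 < p.h1) (hc : 0 < Real.cos p.φ)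
    {g : ℝ → ENNReal} (hg : Measurable g) :
    ∫⁻ x in coverageRegion p, g ‖x‖ = ENNReal.ofReal (2 * Real.pi) *
      ∫⁻ d in Set.Ioc p.h1 p.h2, ∫⁻ r in Set.Ioc d (d / Real.cos p.φ), ENNReal.ofReal r * g r := by
  set c := Real.cos p.φ with hcdef
  set B : Set (ℝ × ℝ) := {q | p.h1 ≤ -q.1 ∧ -q.1 ≤ p.h2 ∧ q.2 * c ≤ -q.1} with hB
  have hq1 : Measurable fun q : ℝ × ℝ => -q.1 := by fun_prop
  have hq2 : Measurable fun q : ℝ × ℝ => q.2 * c := by fun_prop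
  have hBm : MeasurableSet B :=
    (measurableSet_le measurable_const hq1).inter
      ((measurableSet_le hq1 measurable_const).inter (measurableSet_le hq2 hq1))
  have hf : Measurable (B.indicator fun q : ℝ × ℝ => g q.2) :=
    (hg.comp measurable_snd).indicator hBm
  have e1 : ∫⁻ x in coverageRegion p, g ‖x‖ =
      ∫⁻ x : Space, B.indicator (fun q : ℝ × ℝ => g q.2) (x 2, ‖x‖) := by
    rw [← lintegral_indicator (measurableSet_coverageRegion p)]
    rfl
  rw [e1, lintegral_comp_height_norm hf]
  congr 1
  rw [← lintegral_neg_eq_self, setLIntegral_congr Ioc_ae_eq_Icc,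
    ← lintegral_indicator measurableSet_Icc]
  refine lintegral_congr fun d => ?_
  rw [abs_neg]
  by_cases hd : d ∈ Set.Icc p.h1 p.h2
  · have hd0 : 0 < d := h1.trans_le hd.1
    rw [Set.indicator_of_mem hd, abs_of_pos hd0, ← lintegral_indicator measurableSet_Ioi,
      ← lintegral_indicator measurableSet_Ioc]
    refine lintegral_congr fun r => ?_
    have hmem : (-d, r) ∈ B ↔ r ≤ d / c := by
      simp [hB, hd.1, hd.2, le_div_iff₀ hc]
    by_cases h1 : d < r <;> by_cases h2 : r ≤ d / c <;> simp [Set.indicator_apply, hmem, h1, h2]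
  · rw [Set.indicator_of_notMem hd, ← lintegral_zero (μ := volume.restrict (Set.Ioi |d|))]
    refine lintegral_congr fun r => ?_
    have : (-d, r) ∉ B := fun h => hd ⟨by simpa using h.1, by simpa using h.2.1⟩
    rw [Set.indicator_of_notMem this, mul_zero]

/-- The law of the squared distance to the satellite. -/
lemma map_norm_sq_satellite {Ω : Type*} [MeasurableSpace Ω] {P : Measure Ω}
    [IsProbabilityMeasure P] {p : Params} (hwer : 0 < p.wer) (hwmin : 0 < p.wmin) {S : Ω → Space}
    (hS : Measurable S) (hu : pdf.IsUniform S (satelliteCap p) P (orbitSurface p)) :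
    P.map (fun ω => ‖S ω‖ ^ 2) = ENNReal.ofReal (1 / (2 * p.wer * p.wmin)) •
      volume.restrict (Set.Ioc (p.wmin ^ 2) (p.wmax ^ 2)) := by
  have hsq : Measurable fun x : Space => ‖x‖ ^ 2 := by fun_prop
  have hwmax : p.wmax ^ 2 = p.wmin ^ 2 + 2 * p.wer * p.wmin := by
    rw [Params.wmax, Real.sq_sqrt (by positivity)]
  have hprob : IsProbabilityMeasure (P.map fun ω => ‖S ω‖ ^ 2) :=
    Measure.isProbabilityMeasure_map (hsq.comp hS).aemeasurable
  have h : P.map (fun ω => ‖S ω‖ ^ 2) = ((orbitSurface p (satelliteCap p))⁻¹ *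
      ENNReal.ofReal (2 * Real.pi / (2 * (p.wer + p.wmin) * p.wer))) •
        volume.restrict (Set.Ioc (p.wmin ^ 2) (p.wmax ^ 2)) := by
    have hcomp : P.map (fun ω => ‖S ω‖ ^ 2) = (P.map S).map fun x : Space => ‖x‖ ^ 2 :=
      (Measure.map_map hsq hS).symm
    rw [hcomp, hu, ProbabilityTheory.cond,
      Measure.map_smul, map_norm_sq_orbitSurface hwer hwmin, smul_smul]
  rw [eq_smul_restrict_of_isProbabilityMeasure (by rw [hwmax]; nlinarith [mul_pos hwer hwmin]) h,
    hwmax, add_sub_cancel_left]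

/-- The law of the distance to the aerial receiver. -/
lemma lintegral_norm_receiver {Ω : Type*} [MeasurableSpace Ω] {P : Measure Ω}
    [IsProbabilityMeasure P] {p : Params} (h1 : 0 < p.h1) (h12 : p.h1 < p.h2) (hφ : 0 < p.φ)
    (hφ' : p.φ < Real.pi / 2) {T : Ω → Space}
    (hT : Measurable T) (hu : pdf.IsUniform T (coverageRegion p) P volume)
    {g : ℝ → ENNReal} (hg : Measurable g) :
    ∫⁻ v, g v ∂(P.map fun ω => ‖T ω‖) =
      ENNReal.ofReal (6 / ((p.h2 ^ 3 - p.h1 ^ 3) * Real.tan p.φ ^ 2)) *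
        ∫⁻ d in Set.Ioc p.h1 p.h2, ∫⁻ r in Set.Ioc d (d / Real.cos p.φ),
          ENNReal.ofReal r * g r := by
  have hc : 0 < Real.cos p.φ := Real.cos_pos_of_mem_Ioo ⟨by linarith [Real.pi_pos], hφ'⟩
  have htan : 0 < Real.tan p.φ := Real.tan_pos_of_pos_of_lt_pi_div_two hφ hφ'
  have hcube : 0 < p.h2 ^ 3 - p.h1 ^ 3 := sub_pos.2 (pow_lt_pow_left₀ h12 h1.le three_ne_zero)
  set κ := ((volume (coverageRegion p))⁻¹ * ENNReal.ofReal (2 * Real.pi)) with hκ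
  have hlaw : ∀ g : ℝ → ENNReal, Measurable g → ∫⁻ v, g v ∂(P.map fun ω => ‖T ω‖) =
      κ * ∫⁻ d in Set.Ioc p.h1 p.h2, ∫⁻ r in Set.Ioc d (d / Real.cos p.φ),
          ENNReal.ofReal r * g r := by
    intro g hg
    rw [lintegral_map hg (by fun_prop), ← lintegral_map (f := fun x : Space => g ‖x‖) (by fun_prop)
      hT, hu, ProbabilityTheory.cond, lintegral_smul_measure, setLIntegral_coverageRegion h1 hc hg,
      smul_eq_mul, mul_assoc]
  rw [hlaw g hg]
  congr 1
  have hprob : IsProbabilityMeasure (P.map fun ω => ‖T ω‖) :=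
    Measure.isProbabilityMeasure_map (by fun_prop)
  -- The total mass one determines the normalizing constant, so the volume of the truncated cone is
  -- not needed separately.
  have hone := hlaw 1 measurable_one
  simp only [Pi.one_apply, lintegral_const, measure_univ, mul_one] at hone
  have hin : ∀ d ∈ Set.Ioc p.h1 p.h2, ∫⁻ r in Set.Ioc d (d / Real.cos p.φ), ENNReal.ofReal r =
      ENNReal.ofReal (d ^ 2 * (Real.tan p.φ ^ 2 / 2)) := by
    intro d hd
    have hd0 : 0 < d := h1.trans hd.1
    have hdc : d ≤ d / Real.cos p.φ := by
      rw [le_div_iff₀ hc]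
      exact mul_le_of_le_one_right hd0.le (Real.cos_le_one _)
    rw [← ofReal_integral_eq_lintegral_ofReal (Continuous.integrableOn_Ioc (by fun_prop))
      (by filter_upwards [ae_restrict_mem measurableSet_Ioc] with r hr using
        (hd0.trans hr.1).le), ← intervalIntegral.integral_of_le hdc, integral_id]
    congr 1
    rw [Real.tan_eq_sin_div_cos, div_pow, div_pow, Real.sin_sq]
    field_simp
  rw [setLIntegral_congr_fun measurableSet_Ioc hin,
    ← ofReal_integral_eq_lintegral_ofReal (Continuous.integrableOn_Ioc (by fun_prop))
      (Eventually.of_forall fun d => by positivity), ← intervalIntegral.integral_of_le h12.le,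
      intervalIntegral.integral_mul_const, integral_pow] at hone
  rw [ENNReal.eq_inv_of_mul_eq_one_left hone.symm, ← ENNReal.ofReal_inv_of_pos]
  · congr 1
    push_cast
    field_simp
    norm_num
  · push_cast
    norm_num
    positivity


/-! ### The tail of the Rician fading law -/

/-- The tail `∑_{n ≤ m} xⁿ e^(-x) / n!` of the Erlang distribution. -/
def erlangTail (m : ℕ) (x : ℝ) : ℝ :=
  ∑ n ∈ Finset.range (m + 1), x ^ n / (Nat.factorial n : ℝ) * Real.exp (-x)

lemma erlangTail_nonneg (m : ℕ) {x : ℝ} (hx : 0 ≤ x) : 0 ≤ erlangTail m x :=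
  Finset.sum_nonneg fun _ _ => by positivity

lemma erlangTail_le_one (m : ℕ) {x : ℝ} (hx : 0 ≤ x) : erlangTail m x ≤ 1 := by
  rw [erlangTail, ← Finset.sum_mul, Real.exp_neg, ← div_eq_mul_inv,
    div_le_one (Real.exp_pos _)]
  exact Real.sum_le_exp_of_nonneg hx _

@[fun_prop]
lemma continuous_erlangTail (m : ℕ) : Continuous (erlangTail m) := by
  unfold erlangTail
  fun_prop

/-- The derivatives of consecutive terms telescope, and only the one of top degree survives. -/
lemma hasDerivAt_erlangTail (m : ℕ) (x : ℝ) :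
    HasDerivAt (erlangTail m) (-(x ^ m / (Nat.factorial m : ℝ) * Real.exp (-x))) x := by
  have he : HasDerivAt (fun x : ℝ => Real.exp (-x)) (-Real.exp (-x)) x := by
    simpa using (hasDerivAt_neg x).exp
  induction m with
  | zero =>
    have h0 : erlangTail 0 = fun x => Real.exp (-x) := by
      funext x
      simp [erlangTail]
    rw [h0]
    simpa using he
  | succ m ih =>
    have h1 : HasDerivAt (fun x : ℝ => x ^ (m + 1) / (Nat.factorial (m + 1) : ℝ) * Real.exp (-x))
        (x ^ m / (Nat.factorial m : ℝ) * Real.exp (-x) -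
          x ^ (m + 1) / (Nat.factorial (m + 1) : ℝ) * Real.exp (-x)) x := by
      refine ((((hasDerivAt_pow (m + 1) x).div_const _).mul he)).congr_deriv ?_
      rw [Nat.factorial_succ]
      push_cast
      field_simp
      ring_nf
    have h2 : erlangTail (m + 1) = fun x => erlangTail m x +
        x ^ (m + 1) / (Nat.factorial (m + 1) : ℝ) * Real.exp (-x) := by
      funext x
      rw [erlangTail, Finset.sum_range_succ, erlangTail]
    rw [h2]
    exact (ih.add h1).congr_deriv (by ring)

lemma tendsto_erlangTail (m : ℕ) : Tendsto (erlangTail m) atTop (𝓝 0) := by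
  unfold erlangTail
  rw [← Finset.sum_const_zero (s := Finset.range (m + 1)) (ι := ℕ)]
  refine tendsto_finsetSum _ fun n _ => ?_
  have := (Real.tendsto_pow_mul_exp_neg_atTop_nhds_zero n).div_const (Nat.factorial n : ℝ)
  rw [zero_div] at this
  exact this.congr fun x => by ring

lemma lintegral_erlang (m : ℕ) {b y : ℝ} (hb : 0 < b) (hy : 0 ≤ y) :
    ∫⁻ x in Set.Ioi y, ENNReal.ofReal (b * ((b * x) ^ m / (Nat.factorial m : ℝ) *
      Real.exp (-(b * x)))) = ENNReal.ofReal (erlangTail m (b * y)) := by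
  have hd : ∀ x ∈ Set.Ici y, HasDerivAt (fun x => -erlangTail m (b * x))
      (b * ((b * x) ^ m / (Nat.factorial m : ℝ) * Real.exp (-(b * x)))) x := by
    intro x _
    have h1 : HasDerivAt (fun x => b * x) b x := by simpa using (hasDerivAt_id x).const_mul b
    exact ((hasDerivAt_erlangTail m (b * x)).comp x h1).neg.congr_deriv (by ring)
  have hpos : ∀ x ∈ Set.Ioi y, 0 ≤ b * ((b * x) ^ m / (Nat.factorial m : ℝ) *
      Real.exp (-(b * x))) := by
    intro x hx
    have : 0 < x := hy.trans_lt hx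
    positivity
  have ht : Tendsto (fun x => -erlangTail m (b * x)) atTop (𝓝 (-0)) :=
    ((tendsto_erlangTail m).comp (tendsto_id.const_mul_atTop hb)).neg
  rw [← ofReal_integral_eq_lintegral_ofReal (integrableOn_Ioi_deriv_of_nonneg' hd hpos ht)
    ((ae_restrict_mem measurableSet_Ioi).mono hpos),
    integral_Ioi_of_hasDerivAt_of_nonneg' hd hpos ht]
  simp

/-- The tail of the Rician fading law. -/
def ricianTail (p : Params) (y : ℝ) : ℝ :=
  ∑' m : ℕ, Real.exp (-p.K) * p.K ^ m / (Nat.factorial m : ℝ) * erlangTail m ((1 + p.K) * y)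

lemma summable_ricianWeights (K : ℝ) :
    Summable fun m : ℕ => Real.exp (-K) * K ^ m / (Nat.factorial m : ℝ) := by
  simp only [mul_div_assoc]
  exact (Real.summable_pow_div_factorial K).mul_left _

lemma summable_ricianTail {p : Params} (hK : 0 ≤ p.K) {y : ℝ} (hy : 0 ≤ y) :
    Summable fun m : ℕ => Real.exp (-p.K) * p.K ^ m / (Nat.factorial m : ℝ) *
      erlangTail m ((1 + p.K) * y) := by
  have hy' : 0 ≤ (1 + p.K) * y := by positivity
  refine Summable.of_nonneg_of_le (fun m => ?_) (fun m => ?_) (summable_ricianWeights p.K)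
  · exact mul_nonneg (by positivity) (erlangTail_nonneg m hy')
  · exact mul_le_of_le_one_right (by positivity) (erlangTail_le_one m hy')

/-- Expanding `I₀` shows the Rician law to be a mixture, with Poisson weights of mean `K`, of Gamma
laws of shape `m + 1` and rate `1 + K`; their tails are the Erlang sums. -/
lemma hasSum_ricianPDF {p : Params} (hK : 0 ≤ p.K) {x : ℝ} (hx : 0 ≤ x) :
    HasSum (fun m : ℕ => Real.exp (-p.K) * p.K ^ m / (Nat.factorial m : ℝ) *
      ((1 + p.K) * (((1 + p.K) * x) ^ m / (Nat.factorial m : ℝ) *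
        Real.exp (-((1 + p.K) * x))))) (ricianPDF p x) := by
  have hz : 0 ≤ p.K * (1 + p.K) * x := by positivity
  have hterm : ∀ m : ℕ, (2 * Real.sqrt (p.K * (1 + p.K) * x) / 2) ^ (2 * m) /
      ((Nat.factorial m : ℝ) ^ 2) = (p.K * (1 + p.K) * x) ^ m / ((Nat.factorial m : ℝ) ^ 2) := by
    intro m
    rw [mul_div_cancel_left₀ _ two_ne_zero, pow_mul, Real.sq_sqrt hz]
  have hs : Summable fun m : ℕ => (p.K * (1 + p.K) * x) ^ m / ((Nat.factorial m : ℝ) ^ 2) := by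
    refine Summable.of_nonneg_of_le (fun m => by positivity) (fun m => ?_)
      (Real.summable_pow_div_factorial (p.K * (1 + p.K) * x))
    have h1 : (1 : ℝ) ≤ Nat.factorial m := by exact_mod_cast m.factorial_pos
    gcongr
    nlinarith
  have h := hs.hasSum.mul_left ((1 + p.K) * Real.exp (-p.K - (1 + p.K) * x))
  unfold ricianPDF besselI0
  simp only [hterm]
  refine h.congr_fun fun m => ?_
  rw [show -p.K - (1 + p.K) * x = -p.K + -((1 + p.K) * x) by ring, Real.exp_add]
  rw [mul_pow, mul_pow, mul_pow]
  ring

lemma lawOfPDF_rician_Ioi {p : Params} (hK : 0 ≤ p.K) {y : ℝ} (hy : 0 ≤ y) :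
    lawOfPDF (ricianPDF p) (Set.Ioi y) = ENNReal.ofReal (ricianTail p y) := by
  have hb : 0 < 1 + p.K := by linarith
  rw [lawOfPDF, withDensity_apply _ measurableSet_Ioi,
    Measure.restrict_restrict measurableSet_Ioi,
    Set.inter_eq_self_of_subset_left (Set.Ioi_subset_Ioi hy)]
  have e : ∀ x ∈ Set.Ioi y, ENNReal.ofReal (ricianPDF p x) =
      ∑' m : ℕ, ENNReal.ofReal (Real.exp (-p.K) * p.K ^ m / (Nat.factorial m : ℝ)) *
        ENNReal.ofReal ((1 + p.K) * (((1 + p.K) * x) ^ m / (Nat.factorial m : ℝ) *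
        Real.exp (-((1 + p.K) * x)))) := by
    intro x hx
    have hx0 : 0 ≤ x := hy.trans (le_of_lt hx)
    have h := hasSum_ricianPDF hK hx0
    rw [← h.tsum_eq, ENNReal.ofReal_tsum_of_nonneg (fun m => by positivity) h.summable]
    exact tsum_congr fun m => ENNReal.ofReal_mul (by positivity)
  rw [setLIntegral_congr_fun measurableSet_Ioi e, lintegral_tsum (fun m => by fun_prop), ricianTail,
    ENNReal.ofReal_tsum_of_nonneg (fun m => mul_nonneg (by positivity)
      (erlangTail_nonneg m (by positivity))) (summable_ricianTail hK hy)]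
  refine tsum_congr fun m => ?_
  rw [lintegral_const_mul _ (by fun_prop), lintegral_erlang m hb hy,
    ENNReal.ofReal_mul (by positivity)]

lemma ricianTail_nonneg {p : Params} (hK : 0 ≤ p.K) {y : ℝ} (hy : 0 ≤ y) : 0 ≤ ricianTail p y :=
  tsum_nonneg fun m => mul_nonneg (by positivity) (erlangTail_nonneg m (by positivity))


/-! ### The terms of the series as integrals -/

/-- The normalizing constant of the law of the distance to the aerial receiver. -/
def coneConst (p : Params) : ℝ := 6 / ((p.h2 ^ 3 - p.h1 ^ 3) * Real.tan p.φ ^ 2)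

/-- `μ` is the law of the distance between the apex and a uniform point of the coverage region. -/
def IsConeLaw (p : Params) (μ : Measure ℝ) : Prop :=
  ∀ g : ℝ → ENNReal, Measurable g → ∫⁻ v, g v ∂μ =
    ENNReal.ofReal (coneConst p) * ∫⁻ d in Set.Ioc p.h1 p.h2,
      ∫⁻ r in Set.Ioc d (d / Real.cos p.φ), ENNReal.ofReal r * g r

/-! ### Signs of the derived parameters -/

namespace Params.Admissible

lemma cos_pos {p : Params} (hp : p.Admissible) : 0 < Real.cos p.φ :=
  Real.cos_pos_of_mem_Ioo ⟨by linarith [Real.pi_pos, hp.φ_pos], hp.φ_lt⟩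

lemma tan_pos {p : Params} (hp : p.Admissible) : 0 < Real.tan p.φ :=
  Real.tan_pos_of_pos_of_lt_pi_div_two hp.φ_pos hp.φ_lt

lemma cube_pos {p : Params} (hp : p.Admissible) : 0 < p.h2 ^ 3 - p.h1 ^ 3 :=
  sub_pos.2 (pow_lt_pow_left₀ hp.h1_lt hp.h1_pos.le three_ne_zero)

lemma coneConst_pos {p : Params} (hp : p.Admissible) : 0 < coneConst p := by
  have := hp.tan_pos
  have := hp.cube_pos
  unfold coneConst
  positivity

lemma wer_pos {p : Params} (hp : p.Admissible) : 0 < p.wer := add_pos hp.we_pos hp.wr_pos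

lemma wmax_sq {p : Params} (hp : p.Admissible) : p.wmax ^ 2 = p.wmin ^ 2 + 2 * p.wer * p.wmin := by
  have := hp.wer_pos
  have := hp.wmin_pos
  rw [Params.wmax, Real.sq_sqrt (by positivity)]

lemma wmin_sq_lt {p : Params} (hp : p.Admissible) : p.wmin ^ 2 < p.wmax ^ 2 := by
  rw [hp.wmax_sq]
  nlinarith [mul_pos hp.wer_pos hp.wmin_pos]

lemma χρε_pos {p : Params} (hp : p.Admissible) : 0 < p.χρε := by
  have h1 : 0 < 1 - p.ρ := by linarith [hp.ρ_lt]
  refine mul_pos hp.χ_pos ?_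
  rcases hp.harvests with h | h
  · have := hp.ε_nonneg
    positivity
  · have := hp.ρ_nonneg
    positivity

lemma με_pos {p : Params} (hp : p.Admissible) : 0 < p.με := by
  have h1 : 0 < 1 - p.ε := by linarith [hp.ε_lt]
  have := hp.μ_pos
  have := hp.σr2_pos
  have := hp.σrb2_pos
  unfold Params.με
  positivity

lemma calE_pos {p : Params} (hp : p.Admissible) : 0 < p.calE :=
  mul_pos (mul_pos hp.χρε_pos hp.ηs_pos) (by linarith [hp.μ_lt])

lemma calD_pos {p : Params} (hp : p.Admissible) {γ : ℝ} (hγ : 0 < γ) : 0 < p.calD γ :=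
  mul_pos (mul_pos hp.με_pos hp.χρε_pos) hγ

lemma Θ_pos {p : Params} (hp : p.Admissible) {γ : ℝ} (hγ : 0 < γ) : 0 < p.Θ γ :=
  mul_pos (mul_pos (by linarith [hp.K_nonneg]) hp.σt2_pos) hγ

lemma βbar_pos {p : Params} (hp : p.Admissible) : 0 < p.βbar := by
  have hb := hp.bsr_pos
  have hm : (0 : ℝ) < p.msr := by exact_mod_cast hp.msr_pos
  have hO := hp.Ωsr_nonneg
  have : p.βbar = p.msr / (2 * p.bsr * p.msr + p.Ωsr) := by
    unfold Params.βbar Params.βsr Params.δsr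
    field_simp
    ring
  rw [this]
  positivity

/-- The sign is absorbed by the Pochhammer symbol: `(-1)^k (1-m)_k = (m-1)(m-2)⋯(m-k)`. -/
lemma ζ_nonneg {p : Params} (hp : p.Admissible) {k : ℕ} (hk : k < p.msr) : 0 ≤ p.ζ k := by
  have hb := hp.bsr_pos
  have hm : (0 : ℝ) < p.msr := by exact_mod_cast hp.msr_pos
  have hO := hp.Ωsr_nonneg
  have hδ : 0 ≤ p.δsr := by
    unfold Params.δsr
    positivity
  have hk' : (k : ℝ) - 1 ≤ p.msr - 1 := by
    have : (k : ℝ) ≤ p.msr := by exact_mod_cast hk.le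
    linarith
  have hd := descPochhammer_nonneg hk'
  have h1 : (-1 : ℝ) ^ k * (ascPochhammer ℝ k).eval (1 - (p.msr : ℝ)) =
      (descPochhammer ℝ k).eval (p.msr - 1 : ℝ) := by
    rw [← neg_sub (p.msr : ℝ) 1, ascPochhammer_eval_neg_eq_descPochhammer, ← mul_assoc, ← mul_pow]
    simp
  unfold Params.ζ
  rw [h1]
  positivity

lemma αsr_nonneg {p : Params} (hp : p.Admissible) : 0 ≤ p.αsr := by
  have hb := hp.bsr_pos
  have hO := hp.Ωsr_nonneg
  unfold Params.αsr
  positivity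

lemma shadowedRicianPDF_nonneg {p : Params} (hp : p.Admissible) {x : ℝ} (hx : 0 ≤ x) :
    0 ≤ shadowedRicianPDF p x :=
  mul_nonneg hp.αsr_nonneg (Finset.sum_nonneg fun k hk => mul_nonneg (mul_nonneg
    (hp.ζ_nonneg (Finset.mem_range.1 hk)) (pow_nonneg hx k)) (Real.exp_pos _).le)

end Params.Admissible

lemma measurable_lintegral_section {a b : ℝ → ℝ} (ha : Measurable a) (hb : Measurable b)
    {g : ℝ → ENNReal} (hg : Measurable g) :
    Measurable fun d => ∫⁻ r in Set.Ioc (a d) (b d), g r := by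
  have h : ∀ d, ∫⁻ r in Set.Ioc (a d) (b d), g r =
      ∫⁻ r, ({q : ℝ × ℝ | a q.1 < q.2} ∩ {q | q.2 ≤ b q.1}).indicator (fun q => g q.2) (d, r) := by
    intro d
    rw [← lintegral_indicator measurableSet_Ioc]
    rfl
  simp only [h]
  exact ((hg.comp measurable_snd).indicator ((measurableSet_lt (by fun_prop) (by fun_prop)).inter
    (measurableSet_le (by fun_prop) (by fun_prop)))).lintegral_prod_right'

lemma IsConeLaw.ae_pos {p : Params} {μ : Measure ℝ} (h : IsConeLaw p μ) (h1 : 0 < p.h1) :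
    ∀ᵐ v ∂μ, 0 < v := by
  rw [ae_iff]
  simp only [not_lt]
  change μ (Set.Iic 0) = 0
  rw [← lintegral_indicator_one measurableSet_Iic,
    h _ (measurable_one.indicator measurableSet_Iic)]
  have : ∀ d ∈ Set.Ioc p.h1 p.h2, ∫⁻ r in Set.Ioc d (d / Real.cos p.φ), ENNReal.ofReal r *
      (Set.Iic (0 : ℝ)).indicator (1 : ℝ → ENNReal) r = 0 := by
    intro d hd
    rw [setLIntegral_congr_fun (g := fun _ => 0) measurableSet_Ioc]
    · simp
    · intro r hr
      have : r ∉ Set.Iic (0 : ℝ) := not_le.2 ((h1.trans hd.1).trans hr.1)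
      simp only [Set.indicator_of_notMem this, mul_zero]
  rw [setLIntegral_congr_fun measurableSet_Ioc this]
  simp

/-- For non-negative `Φ` the Bochner integrals are the `toReal` of the Lebesgue ones, so
integrability of `Φ` need not be assumed. Continuity makes the inner integrals finite. -/
lemma IsConeLaw.integral_eq {p : Params} (hp : p.Admissible) {μ : Measure ℝ} (h : IsConeLaw p μ)
    {Φ : ℝ → ℝ} (hm : Measurable Φ) (h0 : ∀ v, 0 < v → 0 ≤ Φ v)
    (hc : ContinuousOn Φ (Set.Ioi 0)) :
    ∫ v, Φ v ∂μ = coneConst p *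
      ∫ d in p.h1..p.h2, ∫ r in d..(d / Real.cos p.φ), r * Φ r := by
  have h1 := hp.h1_pos
  have hJ : ∀ d ∈ Set.Ioc p.h1 p.h2, ∫⁻ r in Set.Ioc d (d / Real.cos p.φ),
      ENNReal.ofReal r * ENNReal.ofReal (Φ r) =
      ENNReal.ofReal (∫ r in d..(d / Real.cos p.φ), r * Φ r) ∧
      0 ≤ ∫ r in d..(d / Real.cos p.φ), r * Φ r := by
    intro d hd
    have hd0 : 0 < d := h1.trans hd.1
    have hdc : d ≤ d / Real.cos p.φ := by
      rw [le_div_iff₀ hp.cos_pos]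
      exact mul_le_of_le_one_right hd0.le (Real.cos_le_one _)
    have hci : IntegrableOn (fun r => r * Φ r) (Set.Ioc d (d / Real.cos p.φ)) := by
      refine (ContinuousOn.integrableOn_Icc ?_).mono_set Set.Ioc_subset_Icc_self
      exact (continuousOn_id.mul hc).mono fun r hr => hd0.trans_le hr.1
    have hnn : ∀ᵐ r ∂volume.restrict (Set.Ioc d (d / Real.cos p.φ)), 0 ≤ r * Φ r := by
      filter_upwards [ae_restrict_mem measurableSet_Ioc] with r hr
      have hr0 := hd0.trans hr.1
      exact mul_nonneg hr0.le (h0 r hr0)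
    rw [intervalIntegral.integral_of_le hdc]
    refine ⟨?_, integral_nonneg_of_ae hnn⟩
    rw [ofReal_integral_eq_lintegral_ofReal hci hnn]
    refine setLIntegral_congr_fun measurableSet_Ioc fun r hr => ?_
    exact (ENNReal.ofReal_mul (hd0.trans hr.1).le).symm
  rw [integral_eq_lintegral_of_nonneg_ae ((h.ae_pos h1).mono fun v hv => h0 v hv)
    hm.aestronglyMeasurable, h _ (by fun_prop), ENNReal.toReal_mul,
    ENNReal.toReal_ofReal hp.coneConst_pos.le]
  congr 1
  rw [intervalIntegral.integral_of_le hp.h1_lt.le, ← integral_toReal]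
  · refine setIntegral_congr_fun measurableSet_Ioc fun d hd => ?_
    simp only [(hJ d hd).1]
    exact ENNReal.toReal_ofReal (hJ d hd).2
  · exact (measurable_lintegral_section measurable_id (by fun_prop) (by fun_prop)).aemeasurable
  · filter_upwards [ae_restrict_mem measurableSet_Ioc] with d hd
    rw [(hJ d hd).1]
    exact ENNReal.ofReal_lt_top

lemma measurable_expInt (ς : ℝ) : Measurable (expInt ς) := by
  unfold expInt
  refine (StronglyMeasurable.integral_prod_right ?_).measurable
  refine Measurable.stronglyMeasurable ?_
  unfold Function.uncurry
  fun_prop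

/-- Scaling `z = Q t`. This is the origin of `ς₁ = 1 + k₁ + k₂ - n`: one from `dz`, `ℓ = k₁ + k₂`
from the power, and `-n` from `(q/z)^n`. -/
lemma integral_pow_mul_exp_neg_div (ℓ n : ℕ) (q : ℝ) {Q : ℝ} (hQ : 0 < Q) :
    ∫ z in Set.Ioc 0 Q, z ^ ℓ * ((q / z) ^ n * Real.exp (-(q / z))) =
      q ^ n * Q ^ (1 + (ℓ : ℤ) - n) * expInt ((1 + (ℓ : ℤ) - n : ℤ) : ℝ) (q / Q) := by
  rw [← intervalIntegral.integral_of_le hQ.le]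
  have h := intervalIntegral.mul_integral_comp_mul_left (a := 0) (b := 1)
    (f := fun z : ℝ => z ^ ℓ * ((q / z) ^ n * Real.exp (-(q / z)))) Q
  rw [mul_zero, mul_one] at h
  rw [← h, intervalIntegral.integral_of_le zero_le_one, expInt, ← integral_const_mul,
    ← integral_const_mul]
  refine setIntegral_congr_fun measurableSet_Ioc fun t ht => ?_
  have ht0 : 0 < t := ht.1
  have e1 : t ^ (((1 + (ℓ : ℤ) - n : ℤ) : ℝ) - 1) = t ^ ℓ / t ^ n := by
    push_cast
    rw [show (1 + (ℓ : ℝ) - n - 1) = (ℓ : ℝ) - n by ring, Real.rpow_sub ht0, Real.rpow_natCast,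
      Real.rpow_natCast]
  have e2 : Q ^ (1 + (ℓ : ℤ) - n) = Q * Q ^ ℓ / Q ^ n := by
    rw [zpow_sub₀ hQ.ne', zpow_add₀ hQ.ne', zpow_one, zpow_natCast, zpow_natCast]
  rw [e1, e2, div_div, mul_pow, div_pow, mul_pow]
  field_simp

/-- The dimensionless threshold `Θ v^ν / z` for the aerial link. -/
def linkLevel (p : Params) (γ : ℝ) (y : ℝ × ℝ) : ℝ := p.Θ γ * y.2 ^ p.ν / y.1

@[fun_prop]
lemma measurable_linkLevel (p : Params) (γ : ℝ) : Measurable (linkLevel p γ) := by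
  unfold linkLevel
  fun_prop

/-- Keeps the integrands bounded as `z → 0`, where `linkLevel` is unbounded. -/
lemma pow_mul_exp_neg_le_factorial {x : ℝ} (hx : 0 ≤ x) (n : ℕ) :
    x ^ n * Real.exp (-x) ≤ Nat.factorial n := by
  have h := Real.pow_div_factorial_le_exp x hx n
  rw [div_le_iff₀ (by positivity)] at h
  rw [Real.exp_neg, ← div_eq_mul_inv, div_le_iff₀ (Real.exp_pos _)]
  linarith

/-- The law of the pair formed of `z` (Lebesgue measure) and of the distance to the receiver. -/
abbrev linkMeasure (Q : ℝ) (μ : Measure ℝ) : Measure (ℝ × ℝ) :=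
  (volume.restrict (Set.Ioc 0 Q)).prod μ

lemma ae_linkMeasure {p : Params} {μ : Measure ℝ} [IsProbabilityMeasure μ] (h : IsConeLaw p μ)
    (h1 : 0 < p.h1) (Q : ℝ) :
    ∀ᵐ y ∂linkMeasure Q μ, (0 < y.1 ∧ y.1 ≤ Q) ∧ 0 < y.2 := by
  have e1 : ∀ᵐ y ∂linkMeasure Q μ, y.1 ∈ Set.Ioc 0 Q :=
    Measure.quasiMeasurePreserving_fst.ae (ae_restrict_mem measurableSet_Ioc)
  have e2 : ∀ᵐ y ∂linkMeasure Q μ, 0 < y.2 :=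
    Measure.quasiMeasurePreserving_snd.ae (h.ae_pos h1)
  filter_upwards [e1, e2] with y h1 h2 using ⟨h1, h2⟩

lemma integrable_pow_mul_linkKernel {p : Params} {μ : Measure ℝ} [IsProbabilityMeasure μ]
    (h : IsConeLaw p μ) (h1 : 0 < p.h1) {γ : ℝ} (hΘ : 0 < p.Θ γ) (Q : ℝ) (ℓ n : ℕ) :
    Integrable (fun y => y.1 ^ ℓ * (linkLevel p γ y ^ n * Real.exp (-linkLevel p γ y)))
      (linkMeasure Q μ) := by
  refine (integrable_const (Q ^ ℓ * (Nat.factorial n : ℝ))).mono' (by fun_prop) ?_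
  filter_upwards [ae_linkMeasure h h1 Q] with y hy
  obtain ⟨⟨hz, hzQ⟩, hv⟩ := hy
  have hx : 0 ≤ linkLevel p γ y := by
    unfold linkLevel
    positivity
  rw [Real.norm_of_nonneg (by positivity)]
  have := pow_mul_exp_neg_le_factorial hx n
  have hQ : 0 ≤ Q := hz.le.trans hzQ
  gcongr

lemma integral_pow_mul_linkKernel {p : Params} (hp : p.Admissible) {μ : Measure ℝ}
    [IsProbabilityMeasure μ] (h : IsConeLaw p μ) {Pth γ C : ℝ} (hγ : 0 < γ)
    (hP : 0 < calP p Pth γ C) (ℓ n : ℕ) :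
    ∫ y, y.1 ^ ℓ * (linkLevel p γ y ^ n * Real.exp (-linkLevel p γ y))
        ∂linkMeasure (calP p Pth γ C) μ =
      p.Θ γ ^ n * calP p Pth γ C ^ (1 + (ℓ : ℤ) - n) * (coneConst p / p.ν) *
        bracket p Pth γ C n (1 + (ℓ : ℤ) - n) := by
  have hΘ := hp.Θ_pos hγ
  have hν := hp.ν_pos
  set Q := calP p Pth γ C with hQ
  rw [integral_prod_symm _ (integrable_pow_mul_linkKernel h hp.h1_pos hΘ Q ℓ n)]
  set ς : ℤ := 1 + (ℓ : ℤ) - n with hς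
  have e : ∀ᵐ v ∂μ, ∫ z in Set.Ioc 0 Q, z ^ ℓ *
      (linkLevel p γ (z, v) ^ n * Real.exp (-linkLevel p γ (z, v))) =
      p.Θ γ ^ n * Q ^ ς * (v ^ (p.ν * n) * expInt ς (p.Θ γ / Q * v ^ p.ν)) := by
    filter_upwards [h.ae_pos hp.h1_pos] with v hv
    simp only [linkLevel]
    rw [integral_pow_mul_exp_neg_div ℓ n _ hP, mul_pow, ← Real.rpow_natCast (v ^ p.ν),
      ← Real.rpow_mul hv.le]
    rw [show p.Θ γ * v ^ p.ν / Q = p.Θ γ / Q * v ^ p.ν by ring]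
    ring
  rw [integral_congr_ae e, integral_const_mul, h.integral_eq hp
    (Φ := fun v => v ^ (p.ν * n) * expInt ς (p.Θ γ / Q * v ^ p.ν)),
    bracket_eq hν hp.h1_pos hp.h1_lt.le hp.cos_pos hP hΘ (by omega), ← hQ]
  · field_simp
  · have := measurable_expInt ς
    fun_prop
  · intro v hv
    exact mul_nonneg (Real.rpow_nonneg hv.le _) (expInt_nonneg _ _)
  · refine ContinuousOn.mul (fun r hr => ?_) ((continuousOn_expInt ς).comp (fun r hr => ?_) ?_)
    · exact (Real.continuousAt_rpow_const _ _ (Or.inl (ne_of_gt hr))).continuousWithinAt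
    · exact (continuousAt_const.mul
        (Real.continuousAt_rpow_const _ _ (Or.inl (ne_of_gt hr)))).continuousWithinAt
    · exact fun r hr => mul_pos (div_pos hΘ hP) (Real.rpow_pos_of_pos hr _)

lemma deltaGamma_eq (N : ℕ) {s a b : ℝ} (hs : 0 < s) (ha : 0 ≤ a) (hab : a ≤ b) :
    deltaGamma (N + 1) (s * a) (s * b) =
      s ^ (N + 1) * ∫ w in Set.Ioc a b, w ^ N * Real.exp (-(s * w)) := by
  have hint : IntegrableOn (fun t : ℝ => t ^ ((N : ℝ) + 1 - 1) * Real.exp (-t))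
      (Set.Ioi (s * a)) := by
    refine IntegrableOn.mono_set ?_ (Set.Ioi_subset_Ioi (mul_nonneg hs.le ha))
    refine (Real.GammaIntegral_convergent (s := (N : ℝ) + 1) (by positivity)).congr_fun
      (fun t _ => mul_comm _ _) measurableSet_Ioi
  rw [deltaGamma, upperGamma, upperGamma, intervalIntegral.integral_Ioi_sub_Ioi hint (by gcongr),
    ← intervalIntegral.mul_integral_comp_mul_left, intervalIntegral.integral_of_le hab,
    ← integral_const_mul, ← integral_const_mul]
  refine setIntegral_congr_fun measurableSet_Ioc fun w _ => ?_
  simp only [add_sub_cancel_right, Real.rpow_natCast]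
  ring


/-! ### Summation of the series -/

/-- On a finite measure space a summable sequence of constants suffices for domination. Both
infinite series, over `k₂` and over `m`, are integrated termwise in this way. -/
lemma hasSum_integral_of_bounded {α : Type*} [MeasurableSpace α] {M : Measure α}
    [IsFiniteMeasure M] {F : ℕ → α → ℝ} {f : α → ℝ} {u : ℕ → ℝ}
    (hF : ∀ i, AEStronglyMeasurable (F i) M) (hb : ∀ i, ∀ᵐ a ∂M, ‖F i a‖ ≤ u i)
    (hu : Summable u) (hs : ∀ᵐ a ∂M, HasSum (fun i => F i a) (f a)) :
    Integrable f M ∧ HasSum (fun i => ∫ a, F i a ∂M) (∫ a, f a ∂M) := by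
  constructor
  · have hm : AEStronglyMeasurable f M := by
      refine aestronglyMeasurable_of_tendsto_ae atTop
        (f := fun n a => ∑ i ∈ Finset.range n, F i a) (fun n => ?_) ?_
      · exact Finset.aestronglyMeasurable_fun_sum _ fun i _ => hF i
      · filter_upwards [hs] with a ha using ha.tendsto_sum_nat
    refine (integrable_const (∑' i, u i)).mono' hm ?_
    filter_upwards [hs, ae_all_iff.2 hb] with a ha hba
    rw [← ha.tsum_eq]
    exact tsum_of_norm_bounded hu.hasSum hba
  · exact hasSum_integral_of_dominated_convergence (fun i _ => u i) hF hb
      (Eventually.of_forall fun _ => hu) (integrable_const _) hs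

/-- The measure on triples `(w, z, v)`: squared distance to the satellite, excess power, distance
to the receiver. -/
abbrev tripleMeasure (p : Params) (Q : ℝ) (μ : Measure ℝ) : Measure (ℝ × (ℝ × ℝ)) :=
  (volume.restrict (Set.Ioc (p.wmin ^ 2) (p.wmax ^ 2))).prod (linkMeasure Q μ)

section Series

variable {p : Params} {μ : Measure ℝ} [IsProbabilityMeasure μ] {Pth γ C : ℝ}

lemma ae_tripleMeasure (hp : p.Admissible) (h : IsConeLaw p μ) (Q : ℝ) :
    ∀ᵐ x ∂tripleMeasure p Q μ, (0 < x.1 ∧ x.1 ≤ p.wmax ^ 2) ∧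
      (0 < x.2.1 ∧ x.2.1 ≤ Q) ∧ 0 < x.2.2 := by
  have e1 : ∀ᵐ x ∂tripleMeasure p Q μ, x.1 ∈ Set.Ioc (p.wmin ^ 2) (p.wmax ^ 2) :=
    Measure.quasiMeasurePreserving_fst.ae (ae_restrict_mem measurableSet_Ioc)
  have e2 : ∀ᵐ x ∂tripleMeasure p Q μ, (0 < x.2.1 ∧ x.2.1 ≤ Q) ∧ 0 < x.2.2 :=
    Measure.quasiMeasurePreserving_snd.ae (ae_linkMeasure h hp.h1_pos Q)
  filter_upwards [e1, e2] with x h1 h2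
  exact ⟨⟨(sq_nonneg _).trans_lt h1.1, h1.2⟩, h2⟩

lemma linkLevel_nonneg (hp : p.Admissible) (hγ : 0 < γ) {y : ℝ × ℝ} (h1 : 0 < y.1)
    (h2 : 0 < y.2) : 0 ≤ linkLevel p γ y := by
  have := hp.Θ_pos hγ
  unfold linkLevel
  positivity

/-- The integrand contains the `k₂`-th term of the exponential series of `-β̄zw/C`. It is a product
of a function of `w` and one of `(z, v)`; the former yields `deltaGamma`, the latter `bracket`. -/
lemma innerTerm_eq (hp : p.Admissible) (h : IsConeLaw p μ) (hγ : 0 < γ) (hC : 0 < C)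
    (hP : 0 < calP p Pth γ C) {k k₁ : ℕ} (hk : k₁ ≤ k) (n k₂ : ℕ) :
    p.Θ γ ^ n * innerTerm p Pth γ C k n k₁ k₂ =
      p.ν / coneConst p * (p.calD γ ^ (k - k₁) * (p.βbar / C) ^ (k + 2)) *
        ∫ x, x.1 ^ (k + 1) * Real.exp (-(p.βbar / C * p.calD γ * x.1)) *
          ((-(p.βbar / C * x.2.1 * x.1)) ^ k₂ / (Nat.factorial k₂ : ℝ)) *
          (x.2.1 ^ k₁ * (linkLevel p γ x.2 ^ n * Real.exp (-linkLevel p γ x.2)))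
        ∂tripleMeasure p (calP p Pth γ C) μ := by
  have hD := hp.calD_pos hγ
  have hβ := hp.βbar_pos
  have hκ := hp.coneConst_pos
  have hν := hp.ν_pos
  set D := p.calD γ with hDdef
  set Q := calP p Pth γ C with hQ
  have hs : 0 < p.βbar * D / C := by positivity
  have e : ∀ x : ℝ × (ℝ × ℝ), x.1 ^ (k + 1) * Real.exp (-(p.βbar / C * D * x.1)) *
          ((-(p.βbar / C * x.2.1 * x.1)) ^ k₂ / (Nat.factorial k₂ : ℝ)) *
          (x.2.1 ^ k₁ * (linkLevel p γ x.2 ^ n * Real.exp (-linkLevel p γ x.2))) =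
        (-1) ^ k₂ / (Nat.factorial k₂ : ℝ) * (p.βbar / C) ^ k₂ *
          ((x.1 ^ (k + k₂ + 1) * Real.exp (-(p.βbar * D / C * x.1))) *
          (x.2.1 ^ (k₁ + k₂) * (linkLevel p γ x.2 ^ n * Real.exp (-linkLevel p γ x.2)))) := by
    intro x
    rw [show p.βbar / C * D * x.1 = p.βbar * D / C * x.1 by ring,
      show -(p.βbar / C * x.2.1 * x.1) = (-1) * ((p.βbar / C) * x.2.1 * x.1) by ring, mul_pow,
      mul_pow, mul_pow, pow_add, pow_add x.2.1]
    ring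
  simp only [e]
  rw [integral_const_mul, integral_prod_mul
    (fun w : ℝ => w ^ (k + k₂ + 1) * Real.exp (-(p.βbar * D / C * w)))
    (fun y : ℝ × ℝ => y.1 ^ (k₁ + k₂) *
      (linkLevel p γ y ^ n * Real.exp (-linkLevel p γ y))),
    integral_pow_mul_linkKernel hp h hγ hP (k₁ + k₂) n]
  have hΔ := deltaGamma_eq (k + k₂ + 1) hs (sq_nonneg p.wmin) hp.wmin_sq_lt.le
  unfold innerTerm
  simp only
  rw [← hDdef, ← hQ]
  rw [show ((k : ℝ) + k₂ + 2) = ((k + k₂ + 1 : ℕ) : ℝ) + 1 by push_cast; ring,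
    show p.βbar * D * p.wmin ^ 2 / C = p.βbar * D / C * p.wmin ^ 2 by ring,
    show p.βbar * D * p.wmax ^ 2 / C = p.βbar * D / C * p.wmax ^ 2 by ring, hΔ]
  rw [show (1 + ((k₁ + k₂ : ℕ) : ℤ) - n) = 1 + (k₁ : ℤ) + k₂ - n by push_cast; ring]
  -- Writing `k = k₁ + l` removes the truncated subtraction from the exponent of `𝒟`.
  obtain ⟨l, rfl⟩ := Nat.exists_eq_add_of_le hk
  rw [Nat.add_sub_cancel_left]
  have hpow : (p.βbar * D / C) ^ (k₁ + l + k₂ + 1 + 1) =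
      (p.βbar / C) ^ (k₁ + l + 2) * (p.βbar / C) ^ k₂ * (D ^ (k₁ + k₂ + 2) * D ^ l) := by
    rw [← pow_add, ← pow_add, show p.βbar * D / C = p.βbar / C * D by ring, mul_pow]
    congr 2 <;> ring
  rw [hpow]
  field_simp

lemma hasSum_innerTerm (hp : p.Admissible) (h : IsConeLaw p μ) (hγ : 0 < γ) (hC : 0 < C)
    (hP : 0 < calP p Pth γ C) {k k₁ : ℕ} (hk : k₁ ≤ k) (n : ℕ) :
    Integrable (fun x => x.1 ^ (k + 1) * Real.exp (-(p.βbar / C * (x.2.1 + p.calD γ) * x.1)) *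
          (x.2.1 ^ k₁ * (linkLevel p γ x.2 ^ n * Real.exp (-linkLevel p γ x.2))))
        (tripleMeasure p (calP p Pth γ C) μ) ∧
    HasSum (fun k₂ => p.Θ γ ^ n * innerTerm p Pth γ C k n k₁ k₂)
      (p.ν / coneConst p * (p.calD γ ^ (k - k₁) * (p.βbar / C) ^ (k + 2)) *
        ∫ x, x.1 ^ (k + 1) * Real.exp (-(p.βbar / C * (x.2.1 + p.calD γ) * x.1)) *
          (x.2.1 ^ k₁ * (linkLevel p γ x.2 ^ n * Real.exp (-linkLevel p γ x.2)))
        ∂tripleMeasure p (calP p Pth γ C) μ) := by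
  have hD := hp.calD_pos hγ
  have hβ := hp.βbar_pos
  simp only [innerTerm_eq hp h hγ hC hP hk n]
  set Q := calP p Pth γ C with hQ
  set b := p.wmax ^ 2 with hb
  have hb0 : 0 ≤ b := sq_nonneg _
  have key := hasSum_integral_of_bounded (M := tripleMeasure p Q μ)
    (F := fun k₂ x => x.1 ^ (k + 1) * Real.exp (-(p.βbar / C * p.calD γ * x.1)) *
          ((-(p.βbar / C * x.2.1 * x.1)) ^ k₂ / (Nat.factorial k₂ : ℝ)) *
          (x.2.1 ^ k₁ * (linkLevel p γ x.2 ^ n * Real.exp (-linkLevel p γ x.2))))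
    (f := fun x => x.1 ^ (k + 1) * Real.exp (-(p.βbar / C * (x.2.1 + p.calD γ) * x.1)) *
          (x.2.1 ^ k₁ * (linkLevel p γ x.2 ^ n * Real.exp (-linkLevel p γ x.2))))
    (u := fun k₂ => b ^ (k + 1) * 1 * ((p.βbar / C * Q * b) ^ k₂ / (Nat.factorial k₂ : ℝ)) *
          (Q ^ k₁ * (Nat.factorial n : ℝ)))
    (fun k₂ => Measurable.aestronglyMeasurable (by fun_prop)) (fun k₂ => ?_) ?_ ?_
  · exact ⟨key.1, key.2.mul_left _⟩
  · filter_upwards [ae_tripleMeasure hp h Q] with x hx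
    obtain ⟨⟨hw, hwb⟩, ⟨hz, hzQ⟩, hv⟩ := hx
    have hl := linkLevel_nonneg hp hγ hz hv
    have h1 := pow_mul_exp_neg_le_factorial hl n
    have h2 : Real.exp (-(p.βbar / C * p.calD γ * x.1)) ≤ 1 :=
      Real.exp_le_one_iff.2 (by simp only [Left.neg_nonpos_iff]; positivity)
    rw [norm_mul, norm_mul, norm_div, norm_pow, norm_neg,
      Real.norm_of_nonneg (by positivity : 0 ≤ x.1 ^ (k + 1) * _),
      Real.norm_of_nonneg (by positivity : 0 ≤ p.βbar / C * x.2.1 * x.1),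
      Real.norm_of_nonneg (by positivity : (0 : ℝ) ≤ Nat.factorial k₂),
      Real.norm_of_nonneg (by positivity : 0 ≤ x.2.1 ^ k₁ * _)]
    gcongr
  · exact ((Real.summable_pow_div_factorial _).mul_left _).mul_right _
  -- Summed over `k₂`, the exponential series merges with the factor `e^(-β̄𝒟w/C)`.
  · refine Eventually.of_forall fun x => ?_
    have hexp := NormedSpace.expSeries_div_hasSum_exp (-(p.βbar / C * x.2.1 * x.1))
    rw [← Real.exp_eq_exp_ℝ] at hexp
    have := (hexp.mul_left (x.1 ^ (k + 1) * Real.exp (-(p.βbar / C * p.calD γ * x.1)))).mul_right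
      (x.2.1 ^ k₁ * (linkLevel p γ x.2 ^ n * Real.exp (-linkLevel p γ x.2)))
    rw [mul_assoc (x.1 ^ (k + 1)), ← Real.exp_add, show -(p.βbar / C * p.calD γ * x.1) +
      -(p.βbar / C * x.2.1 * x.1) = -(p.βbar / C * (x.2.1 + p.calD γ) * x.1) by ring] at this
    exact this

lemma summable_innerTerm (hp : p.Admissible) (h : IsConeLaw p μ) (hγ : 0 < γ) (hC : 0 < C)
    (hP : 0 < calP p Pth γ C) {k k₁ : ℕ} (hk : k₁ ≤ k) (n : ℕ) :
    Summable fun k₂ => innerTerm p Pth γ C k n k₁ k₂ :=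
  (summable_mul_left_iff (pow_pos (hp.Θ_pos hγ) n).ne').1
    (hasSum_innerTerm hp h hγ hC hP hk n).2.summable

/-- The sum over `k₁` reassembles `(z + 𝒟)^k` by the binomial theorem, and the sum over `n`
reassembles the Erlang tail. -/
lemma outerTerm_eq (hp : p.Admissible) (h : IsConeLaw p μ) (hγ : 0 < γ) (hC : 0 < C)
    (hP : 0 < calP p Pth γ C) (k m : ℕ) :
    outerTerm p Pth γ C k m = p.ν / coneConst p * (p.βbar / C) ^ (k + 2) *
      ∫ x, x.1 ^ (k + 1) * (x.2.1 + p.calD γ) ^ k *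
          Real.exp (-(p.βbar / C * (x.2.1 + p.calD γ) * x.1)) *
          (p.K ^ m / (Nat.factorial m : ℝ) * erlangTail m (linkLevel p γ x.2))
        ∂tripleMeasure p (calP p Pth γ C) μ := by
  set Q := calP p Pth γ C with hQ
  set D := p.calD γ with hD
  set f : ℕ → ℕ → ℝ × (ℝ × ℝ) → ℝ := fun n k₁ x =>
    x.1 ^ (k + 1) * Real.exp (-(p.βbar / C * (x.2.1 + D) * x.1)) *
      (x.2.1 ^ k₁ * (linkLevel p γ x.2 ^ n * Real.exp (-linkLevel p γ x.2))) with hf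
  have e : ∀ x : ℝ × (ℝ × ℝ), x.1 ^ (k + 1) * (x.2.1 + D) ^ k *
          Real.exp (-(p.βbar / C * (x.2.1 + D) * x.1)) *
          (p.K ^ m / (Nat.factorial m : ℝ) * erlangTail m (linkLevel p γ x.2)) =
      ∑ n ∈ Finset.range (m + 1), ∑ k₁ ∈ Finset.range (k + 1),
        p.K ^ m / ((Nat.factorial m : ℝ) * (Nat.factorial n : ℝ)) *
          ((Nat.choose k k₁ : ℝ) * D ^ (k - k₁)) * f n k₁ x := by
    intro x
    rw [erlangTail, Finset.mul_sum, Finset.mul_sum]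
    refine Finset.sum_congr rfl fun n _ => ?_
    rw [add_pow, Finset.mul_sum, Finset.sum_mul, Finset.sum_mul]
    refine Finset.sum_congr rfl fun k₁ _ => ?_
    simp only [hf]
    field_simp
  simp only [e]
  have hint : ∀ n, ∀ k₁ ∈ Finset.range (k + 1), Integrable (f n k₁) (tripleMeasure p Q μ) :=
    fun n k₁ hk => (hasSum_innerTerm hp h hγ hC hP (Finset.mem_range_succ_iff.1 hk) n).1
  have hint' : ∀ n ∈ Finset.range (m + 1), Integrable (fun x => ∑ k₁ ∈ Finset.range (k + 1),
      p.K ^ m / ((Nat.factorial m : ℝ) * (Nat.factorial n : ℝ)) *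
        ((Nat.choose k k₁ : ℝ) * D ^ (k - k₁)) * f n k₁ x) (tripleMeasure p Q μ) :=
    fun n _ => integrable_finsetSum _ fun k₁ hk => (hint n k₁ hk).const_mul _
  rw [integral_finsetSum _ hint', outerTerm, Finset.mul_sum]
  refine Finset.sum_congr rfl fun n _ => ?_
  rw [integral_finsetSum _ fun k₁ hk => (hint n k₁ hk).const_mul _, Finset.mul_sum,
    Finset.mul_sum]
  refine Finset.sum_congr rfl fun k₁ hk => ?_
  have hk' := Finset.mem_range_succ_iff.1 hk
  have hs := (hasSum_innerTerm hp h hγ hC hP hk' n).2.tsum_eq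
  rw [tsum_mul_left] at hs
  rw [integral_const_mul]
  have : p.K ^ m * p.Θ γ ^ n / ((Nat.factorial m : ℝ) * (Nat.factorial n : ℝ)) *
      ((Nat.choose k k₁ : ℝ) * ∑' k₂, innerTerm p Pth γ C k n k₁ k₂) =
      p.K ^ m / ((Nat.factorial m : ℝ) * (Nat.factorial n : ℝ)) * (Nat.choose k k₁ : ℝ) *
        (p.Θ γ ^ n * ∑' k₂, innerTerm p Pth γ C k n k₁ k₂) := by ring
  rw [this, hs]
  ring

/-- The argument `σ_t² γ v^ν / z` of the tail of the Rician law. -/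
def tailLevel (p : Params) (γ : ℝ) (y : ℝ × ℝ) : ℝ := p.σt2 * γ * y.2 ^ p.ν / y.1

lemma tailLevel_nonneg (hp : p.Admissible) (hγ : 0 < γ) {y : ℝ × ℝ} (h1 : 0 < y.1)
    (h2 : 0 < y.2) : 0 ≤ tailLevel p γ y := by
  have := hp.σt2_pos
  unfold tailLevel
  positivity

lemma linkLevel_eq (p : Params) (γ : ℝ) (y : ℝ × ℝ) :
    linkLevel p γ y = (1 + p.K) * tailLevel p γ y := by
  unfold linkLevel tailLevel Params.Θ
  ring

/-- With the factor `e^(-K)` the weights over `m` are those of the Poisson law. Since Erlang tails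
are at most `1`, these weights dominate up to a constant. -/
lemma hasSum_outerTerm (hp : p.Admissible) (h : IsConeLaw p μ) (hγ : 0 < γ) (hC : 0 < C)
    (hP : 0 < calP p Pth γ C) (k : ℕ) :
    Integrable (fun x => x.1 ^ (k + 1) * (x.2.1 + p.calD γ) ^ k *
          Real.exp (-(p.βbar / C * (x.2.1 + p.calD γ) * x.1)) * ricianTail p (tailLevel p γ x.2))
        (tripleMeasure p (calP p Pth γ C) μ) ∧
    HasSum (fun m => Real.exp (-p.K) * outerTerm p Pth γ C k m)
      (p.ν / coneConst p * (p.βbar / C) ^ (k + 2) *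
        ∫ x, x.1 ^ (k + 1) * (x.2.1 + p.calD γ) ^ k *
          Real.exp (-(p.βbar / C * (x.2.1 + p.calD γ) * x.1)) * ricianTail p (tailLevel p γ x.2)
        ∂tripleMeasure p (calP p Pth γ C) μ) := by
  have hD := hp.calD_pos hγ
  have hβ := hp.βbar_pos
  have hK := hp.K_nonneg
  simp only [outerTerm_eq hp h hγ hC hP]
  set Q := calP p Pth γ C with hQ
  set D := p.calD γ
  set b := p.wmax ^ 2 with hb
  have hb0 : 0 ≤ b := sq_nonneg _
  have key := hasSum_integral_of_bounded (M := tripleMeasure p Q μ)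
    (F := fun m x => Real.exp (-p.K) * (x.1 ^ (k + 1) * (x.2.1 + D) ^ k *
          Real.exp (-(p.βbar / C * (x.2.1 + D) * x.1)) *
          (p.K ^ m / (Nat.factorial m : ℝ) * erlangTail m (linkLevel p γ x.2))))
    (f := fun x => x.1 ^ (k + 1) * (x.2.1 + D) ^ k *
          Real.exp (-(p.βbar / C * (x.2.1 + D) * x.1)) * ricianTail p (tailLevel p γ x.2))
    (u := fun m => Real.exp (-p.K) * (b ^ (k + 1) * (Q + D) ^ k * 1 *
      (p.K ^ m / (Nat.factorial m : ℝ) * 1)))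
    (fun m => Measurable.aestronglyMeasurable (by fun_prop)) (fun m => ?_) ?_ ?_
  · refine ⟨key.1, ?_⟩
    have h2 := key.2.mul_left (p.ν / coneConst p * (p.βbar / C) ^ (k + 2))
    simp only [integral_const_mul] at h2
    refine h2.congr_fun fun m => ?_
    ring
  · filter_upwards [ae_tripleMeasure hp h Q] with x hx
    obtain ⟨⟨hw, hwb⟩, ⟨hz, hzQ⟩, hv⟩ := hx
    have hl := linkLevel_nonneg hp hγ hz hv
    have h1 := erlangTail_le_one m hl
    have h0 := erlangTail_nonneg m hl
    have h2 : Real.exp (-(p.βbar / C * (x.2.1 + D) * x.1)) ≤ 1 :=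
      Real.exp_le_one_iff.2 (by simp only [Left.neg_nonpos_iff]; positivity)
    rw [Real.norm_of_nonneg (by positivity)]
    gcongr
  · simp only [mul_one]
    exact ((Real.summable_pow_div_factorial _).mul_left _).mul_left _
  · filter_upwards [ae_tripleMeasure hp h Q] with x hx
    obtain ⟨-, ⟨hz, -⟩, hv⟩ := hx
    have hs := (summable_ricianTail hK (tailLevel_nonneg hp hγ hz hv)).hasSum.mul_left
      (x.1 ^ (k + 1) * (x.2.1 + D) ^ k * Real.exp (-(p.βbar / C * (x.2.1 + D) * x.1)))
    rw [← ricianTail] at hs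
    refine hs.congr_fun fun m => ?_
    rw [linkLevel_eq]
    ring

lemma psi1Converges (hp : p.Admissible) (h : IsConeLaw p μ) (hγ : 0 < γ) (hC : 0 < C)
    (hP : 0 < calP p Pth γ C) : Psi1Converges p Pth γ C := fun k _ =>
  ⟨fun n _ hk => summable_innerTerm hp h hγ hC hP hk n,
    (summable_mul_left_iff (Real.exp_pos _).ne').1 (hasSum_outerTerm hp h hγ hC hP k).2.summable⟩

/-- The joint density of `(w, z, v)` times the conditional probability that the aerial link is good
enough. -/
def successDensity (p : Params) (γ C : ℝ) (x : ℝ × (ℝ × ℝ)) : ℝ :=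
  1 / (2 * p.wer * p.wmin) *
    (x.1 / C * shadowedRicianPDF p ((x.2.1 + p.calD γ) * x.1 / C)) *
      ricianTail p (tailLevel p γ x.2)

/-- The sum over `k` restores the shadowed Rician density at `(z + 𝒟)w/C`. The constant `3` of the
series is the `6` of `coneConst` divided by the `2` of `1/(2 w_er w_min)`. -/
theorem psi1_eq_integral (hp : p.Admissible) (h : IsConeLaw p μ) (hγ : 0 < γ) (hC : 0 < C)
    (hP : 0 < calP p Pth γ C) :
    Integrable (successDensity p γ C) (tripleMeasure p (calP p Pth γ C) μ) ∧
    Psi1 p Pth γ C = ∫ x, successDensity p γ C x ∂tripleMeasure p (calP p Pth γ C) μ := by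
  have hβ := hp.βbar_pos
  have hwer := hp.wer_pos
  have hwmin := hp.wmin_pos
  have hν := hp.ν_pos
  have hcube := hp.cube_pos
  have htan := hp.tan_pos
  set M := tripleMeasure p (calP p Pth γ C) μ with hM
  set F : ℕ → ℝ × (ℝ × ℝ) → ℝ := fun k x => x.1 ^ (k + 1) * (x.2.1 + p.calD γ) ^ k *
          Real.exp (-(p.βbar / C * (x.2.1 + p.calD γ) * x.1)) * ricianTail p (tailLevel p γ x.2)
    with hF
  have hFi : ∀ k, Integrable (F k) M := fun k => (hasSum_outerTerm hp h hγ hC hP k).1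
  have hFs : ∀ k, Real.exp (-p.K) * ∑' m, outerTerm p Pth γ C k m =
      p.ν / coneConst p * (p.βbar / C) ^ (k + 2) * ∫ x, F k x ∂M := fun k => by
    rw [← (hasSum_outerTerm hp h hγ hC hP k).2.tsum_eq, tsum_mul_left]
  have e : successDensity p γ C = fun x => ∑ k ∈ Finset.range p.msr,
      1 / (2 * p.wer * p.wmin) * p.αsr * p.ζ k / C ^ (k + 1) * F k x := by
    funext x
    simp only [successDensity, shadowedRicianPDF, hF]
    rw [Finset.mul_sum, Finset.mul_sum, Finset.mul_sum, Finset.sum_mul]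
    refine Finset.sum_congr rfl fun k _ => ?_
    rw [show -(p.βsr - p.δsr) * ((x.2.1 + p.calD γ) * x.1 / C) =
      -(p.βbar / C * (x.2.1 + p.calD γ) * x.1) by rw [Params.βbar]; ring, div_pow, mul_pow]
    field_simp
    ring
  rw [e]
  refine ⟨integrable_finsetSum _ fun k _ => (hFi k).const_mul _, ?_⟩
  rw [integral_finsetSum _ fun k _ => (hFi k).const_mul _, Psi1, Finset.mul_sum]
  refine Finset.sum_congr rfl fun k _ => ?_
  rw [integral_const_mul]
  have : p.ζ k * Real.exp (-p.K) / p.βbar ^ (k + 2) * ∑' m, outerTerm p Pth γ C k m =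
      p.ζ k / p.βbar ^ (k + 2) * (Real.exp (-p.K) * ∑' m, outerTerm p Pth γ C k m) := by ring
  rw [this, hFs, coneConst, div_pow]
  field_simp
  ring

end Series


/-! ### The success probability -/

/-- The excess power `ℰ x / w - 𝒟`. -/
def excess (p : Params) (γ w x : ℝ) : ℝ := p.calE * (x / w) - p.calD γ

lemma calP_calE (p : Params) (Pth γ : ℝ) :
    calP p Pth γ p.calE = Pth / p.ηs * p.calE - p.calD γ := by
  unfold calP
  ring

/-- Signal and amplified noise are both linear in the aerial gain, so after clearing the positive
denominator they combine into one multiple of it, the excess power. -/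
lemma lt_snrPIC1_iff {p : Params} (hp : p.Admissible) {γ : ℝ} (s t : Space) (gs gt : ℂ) :
    γ < snrPIC1 p s t gs gt ↔
      p.σt2 * γ < excess p γ (‖s‖ ^ 2) (‖gs‖ ^ 2) * aerialGain p t gt := by
  have h1 := hp.με_pos
  have h2 := hp.χρε_pos
  have h3 := hp.σt2_pos
  have hg : 0 ≤ aerialGain p t gt := by
    unfold aerialGain
    positivity
  rw [snrPIC1, lt_div_iff₀ (by positivity)]
  have e : excess p γ (‖s‖ ^ 2) (‖gs‖ ^ 2) * aerialGain p t gt =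
      (1 - p.μ) * p.χρε * rxPower p s gs * aerialGain p t gt -
        γ * (p.με * p.χρε * aerialGain p t gt) := by
    unfold excess rxPower Params.calE Params.calD
    ring
  rw [e]
  constructor <;> intro h <;> linarith

/-- Valid also at `s = 0`: both sides use the same convention `0⁻¹ = 0`. -/
lemma rxPower_le_iff {p : Params} (hp : p.Admissible) {Pth γ : ℝ} (s : Space) (gs : ℂ) :
    rxPower p s gs ≤ Pth ↔ excess p γ (‖s‖ ^ 2) (‖gs‖ ^ 2) ≤ calP p Pth γ p.calE := by
  have hη := hp.ηs_pos
  have hE := hp.calE_pos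
  rw [calP_calE, excess, sub_le_sub_iff_right, mul_comm p.calE, mul_le_mul_iff_left₀ hE,
    le_div_iff₀ hη, rxPower, div_eq_mul_inv]
  constructor <;> intro h <;> linarith

lemma excess_pos_of_lt_snrPIC1 {p : Params} (hp : p.Admissible) {γ : ℝ} (hγ : 0 < γ) {s t : Space}
    {gs gt : ℂ} (h : γ < snrPIC1 p s t gs gt) : 0 < excess p γ (‖s‖ ^ 2) (‖gs‖ ^ 2) := by
  rw [lt_snrPIC1_iff hp] at h
  have h3 := mul_pos hp.σt2_pos hγ
  have hg : 0 ≤ aerialGain p t gt := by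
    unfold aerialGain
    positivity
  exact pos_of_mul_pos_left (h3.trans h) hg

/-- The set of the values of `((w, x), (v, y))` that correspond to a success. -/
def successSet (p : Params) (Pth γ : ℝ) : Set ((ℝ × ℝ) × (ℝ × ℝ)) :=
  {q | (0 < excess p γ q.1.1 q.1.2 ∧ excess p γ q.1.1 q.1.2 ≤ calP p Pth γ p.calE) ∧
    tailLevel p γ (excess p γ q.1.1 q.1.2, q.2.1) < q.2.2}

lemma measurable_excess (p : Params) (γ : ℝ) :
    Measurable fun q : ℝ × ℝ => excess p γ q.1 q.2 := by
  unfold excess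
  fun_prop

@[fun_prop]
lemma measurable_tailLevel (p : Params) (γ : ℝ) : Measurable (tailLevel p γ) := by
  unfold tailLevel
  fun_prop

lemma measurableSet_successSet (p : Params) (Pth γ : ℝ) :
    MeasurableSet (successSet p Pth γ) := by
  have h1 : Measurable fun q : (ℝ × ℝ) × (ℝ × ℝ) => excess p γ q.1.1 q.1.2 :=
    (measurable_excess p γ).comp measurable_fst
  have h2 : Measurable fun q : (ℝ × ℝ) × (ℝ × ℝ) =>
      tailLevel p γ (excess p γ q.1.1 q.1.2, q.2.1) :=
    (measurable_tailLevel p γ).comp (h1.prodMk (by fun_prop))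
  exact ((measurableSet_lt measurable_const h1).inter
    (measurableSet_le h1 measurable_const)).inter (measurableSet_lt h2 (by fun_prop))

lemma success_iff {p : Params} (hp : p.Admissible) {Pth γ : ℝ} (hγ : 0 < γ) {s t : Space}
    (ht : 0 < ‖t‖) (gs gt : ℂ) :
    (γ < snrPIC1 p s t gs gt ∧ rxPower p s gs ≤ Pth) ↔
      ((‖s‖ ^ 2, ‖gs‖ ^ 2), (‖t‖, ‖gt‖ ^ 2)) ∈ successSet p Pth γ := by
  have hv : 0 < ‖t‖ ^ p.ν := Real.rpow_pos_of_pos ht _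
  simp only [successSet, Set.mem_ofPred_eq, rxPower_le_iff hp (γ := γ)]
  have key : 0 < excess p γ (‖s‖ ^ 2) (‖gs‖ ^ 2) → (γ < snrPIC1 p s t gs gt ↔
      tailLevel p γ (excess p γ (‖s‖ ^ 2) (‖gs‖ ^ 2), ‖t‖) < ‖gt‖ ^ 2) := by
    intro hz
    rw [lt_snrPIC1_iff hp, tailLevel, aerialGain, Real.rpow_neg ht.le, ← div_eq_mul_inv,
      div_lt_iff₀ hz, ← mul_div_assoc, lt_div_iff₀ hv, mul_comm (‖gt‖ ^ 2)]
  constructor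
  · rintro ⟨h1, h2⟩
    have hz := excess_pos_of_lt_snrPIC1 hp hγ h1
    exact ⟨⟨hz, h2⟩, (key hz).1 h1⟩
  · rintro ⟨⟨hz, h2⟩, h1⟩
    exact ⟨(key hz).2 h1, h2⟩

/-- At fixed `w` the excess power is affine in `x`; its inverse `x = (z + 𝒟)w/ℰ` has derivative
`w/ℰ`. -/
lemma lintegral_lawOfPDF_excess {p : Params} (hp : p.Admissible) {γ w : ℝ} (hγ : 0 < γ)
    (hw : 0 < w) (Q : ℝ) (hf : Measurable (shadowedRicianPDF p)) {H : ℝ → ENNReal}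
    (hH : Measurable H) :
    ∫⁻ x, (Set.Ioc 0 Q).indicator H (excess p γ w x) ∂lawOfPDF (shadowedRicianPDF p) =
      ∫⁻ z in Set.Ioc 0 Q, ENNReal.ofReal
        (w / p.calE * shadowedRicianPDF p ((z + p.calD γ) * w / p.calE)) * H z := by
  have hE := hp.calE_pos
  have hD := hp.calD_pos hγ
  have hem : Measurable fun x => excess p γ w x :=
    (measurable_excess p γ).comp measurable_prodMk_left
  set T : ℝ → ℝ := fun z => (z + p.calD γ) * w / p.calE with hT
  have hexT : ∀ z, excess p γ w (T z) = z := fun z => by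
    simp only [excess, hT]
    field_simp
    ring
  have hTex : ∀ x, T (excess p γ w x) = x := fun x => by
    simp only [excess, hT]
    field_simp
    ring
  have himg : ∀ x, x ∈ T '' Set.Ioc 0 Q ↔ excess p γ w x ∈ Set.Ioc 0 Q := fun x =>
    ⟨by rintro ⟨z, hz, rfl⟩; rwa [hexT], fun h => ⟨_, h, hTex x⟩⟩
  have hTm : MeasurableSet (T '' Set.Ioc 0 Q) := by
    have : T '' Set.Ioc 0 Q = (fun x => excess p γ w x) ⁻¹' Set.Ioc 0 Q := Set.ext himg
    rw [this]
    exact hem measurableSet_Ioc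
  -- Because `𝒟 > 0`, a positive excess forces `x > 0`, so the restriction of the law to the
  -- half-line cuts nothing off.
  have hsub : T '' Set.Ioc 0 Q ⊆ Set.Ioi 0 := by
    rintro _ ⟨z, hz, rfl⟩
    have := hz.1
    simp only [hT, Set.mem_Ioi]
    positivity
  have hHe : Measurable fun x => (Set.Ioc 0 Q).indicator H (excess p γ w x) :=
    (hH.indicator measurableSet_Ioc).comp hem
  rw [lawOfPDF, lintegral_withDensity_eq_lintegral_mul _ (by fun_prop) hHe]
  have e1 : ∫⁻ x in Set.Ioi 0, ((fun x => ENNReal.ofReal (shadowedRicianPDF p x)) *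
        fun x => (Set.Ioc 0 Q).indicator H (excess p γ w x)) x =
      ∫⁻ x in T '' Set.Ioc 0 Q, ENNReal.ofReal (shadowedRicianPDF p x) * H (excess p γ w x) := by
    rw [← lintegral_indicator measurableSet_Ioi, ← lintegral_indicator hTm]
    refine lintegral_congr fun x => ?_
    by_cases hx : x ∈ T '' Set.Ioc 0 Q
    · rw [Set.indicator_of_mem (hsub hx), Set.indicator_of_mem hx, Pi.mul_apply,
        Set.indicator_of_mem ((himg x).1 hx)]
    · rw [Set.indicator_of_notMem hx]
      by_cases hx0 : x ∈ Set.Ioi 0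
      · rw [Set.indicator_of_mem hx0, Pi.mul_apply,
          Set.indicator_of_notMem (mt (himg x).2 hx), mul_zero]
      · rw [Set.indicator_of_notMem hx0]
  have hTd : ∀ z ∈ Set.Ioc 0 Q, HasDerivWithinAt T (w / p.calE) (Set.Ioc 0 Q) z := by
    intro z _
    have := (((hasDerivAt_id z).add_const (p.calD γ)).mul_const w).div_const p.calE
    rw [one_mul] at this
    exact this.hasDerivWithinAt
  have hinj : Set.InjOn T (Set.Ioc 0 Q) := fun a _ b _ hab => by
    rw [← hexT a, ← hexT b, hab]
  rw [e1, lintegral_image_eq_lintegral_abs_deriv_mul measurableSet_Ioc hTd hinj]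
  refine setLIntegral_congr_fun measurableSet_Ioc fun z hz => ?_
  have : 0 ≤ w / p.calE := by positivity
  rw [hexT, abs_of_nonneg this, ← mul_assoc, ← ENNReal.ofReal_mul this]

lemma measurable_shadowedRicianPDF (p : Params) : Measurable (shadowedRicianPDF p) := by
  unfold shadowedRicianPDF
  fun_prop

section Model

variable {Ω : Type*} [MeasurableSpace Ω] {P : Measure Ω} {p : Params}
  {S T : Ω → Space} {gsr grt : Ω → ℂ}

lemma IsModel.measurableSet_success (hM : IsModel P p S T gsr grt) (Pth γ : ℝ) :
    MeasurableSet {ω | γ < snrPIC1 p (S ω) (T ω) (gsr ω) (grt ω) ∧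
      rxPower p (S ω) (gsr ω) ≤ Pth} := by
  have mS := hM.measurable_S
  have mT := hM.measurable_T
  have mg := hM.measurable_gsr
  have mh := hM.measurable_grt
  have h1 : Measurable fun ω => snrPIC1 p (S ω) (T ω) (gsr ω) (grt ω) := by
    unfold snrPIC1 rxPower aerialGain
    fun_prop
  have h2 : Measurable fun ω => rxPower p (S ω) (gsr ω) := by
    unfold rxPower
    fun_prop
  exact (measurableSet_lt measurable_const h1).inter (measurableSet_le h2 measurable_const)

/-- On the event the excess would be both positive and at most `𝒫 ≤ 0`. -/
lemma P5_eq_zero (hp : p.Admissible) {Pth γ : ℝ}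
    (hγ : 0 < γ) (hP : calP p Pth γ p.calE ≤ 0) : P5 P p S T gsr grt Pth γ = 0 := by
  have : {ω | γ < snrPIC1 p (S ω) (T ω) (gsr ω) (grt ω) ∧ rxPower p (S ω) (gsr ω) ≤ Pth} = ∅ := by
    ext ω
    simp only [Set.mem_ofPred_eq, Set.mem_empty_iff_false, iff_false, not_and]
    intro h1 h2
    rw [rxPower_le_iff hp (γ := γ)] at h2
    exact absurd (excess_pos_of_lt_snrPIC1 hp hγ h1) (not_lt.2 (h2.trans hP))
  rw [P5, this, measureReal_empty]

variable [IsProbabilityMeasure P]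

lemma IsModel.isConeLaw (hp : p.Admissible) (hM : IsModel P p S T gsr grt) :
    IsConeLaw p (P.map fun ω => ‖T ω‖) := fun _ hg =>
  lintegral_norm_receiver hp.h1_pos hp.h1_lt hp.φ_pos hp.φ_lt hM.measurable_T
    hM.receiver_uniform hg

lemma IsModel.map_eq_prod (hM : IsModel P p S T gsr grt) :
    P.map (fun ω => ((‖S ω‖ ^ 2, ‖gsr ω‖ ^ 2), (‖T ω‖, ‖grt ω‖ ^ 2))) =
      ((P.map fun ω => ‖S ω‖ ^ 2).prod (lawOfPDF (shadowedRicianPDF p))).prod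
        ((P.map fun ω => ‖T ω‖).prod (lawOfPDF (ricianPDF p))) := by
  have mS := hM.measurable_S
  have mT := hM.measurable_T
  have mg := hM.measurable_gsr
  have mh := hM.measurable_grt
  set f : Fin 4 → Ω → ℝ := ![fun ω => ‖S ω‖ ^ 2, fun ω => ‖T ω‖, fun ω => ‖gsr ω‖ ^ 2,
    fun ω => ‖grt ω‖ ^ 2] with hf
  have hfm : ∀ i, Measurable (f i) := by
    intro i
    fin_cases i <;> simp [hf] <;> fun_prop
  have hle : ∀ i, MeasurableSpace.comap (f i) inferInstance ≤
      (![MeasurableSpace.comap S inferInstance, MeasurableSpace.comap T inferInstance,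
      MeasurableSpace.comap gsr inferInstance, MeasurableSpace.comap grt inferInstance] :
        Fin 4 → MeasurableSpace Ω) i := by
    intro i
    fin_cases i
    · exact ((measurable_norm.pow_const 2).comp (comap_measurable S)).comap_le
    · exact (measurable_norm.comp (comap_measurable T)).comap_le
    · exact ((measurable_norm.pow_const 2).comp (comap_measurable gsr)).comap_le
    · exact ((measurable_norm.pow_const 2).comp (comap_measurable grt)).comap_le
  have hind : iIndepFun f P := by
    rw [iIndepFun_iff_iIndep, iIndep_iff]
    intro s t ht
    exact (iIndep_iff _ _).1 hM.independent s fun i hi => hle i _ (ht i hi)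
  -- The satellite pair, which determines the excess, is grouped apart from the aerial pair.
  have h1 := hind.indepFun_prodMk_prodMk hfm 0 2 1 3 (by decide) (by decide) (by decide)
    (by decide)
  have h2 := hind.indepFun (i := 0) (j := 2) (by decide)
  have h3 := hind.indepFun (i := 1) (j := 3) (by decide)
  rw [indepFun_iff_map_prod_eq_prod_map_map (by fun_prop) (by fun_prop)] at h1 h2 h3
  rw [h2, h3] at h1
  simp only [hf, Matrix.cons_val_zero, Matrix.cons_val_one, Matrix.cons_val] at h1
  rw [hM.satellite_fading.map_eq, hM.aerial_fading.map_eq] at h1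
  exact h1

/-- The success probability as a triple integral. -/
theorem P5_eq_integral (hp : p.Admissible) (hM : IsModel P p S T gsr grt) {Pth γ : ℝ}
    (hγ : 0 < γ) (hP : 0 < calP p Pth γ p.calE) :
    P5 P p S T gsr grt Pth γ = ∫ x, successDensity p γ p.calE x
      ∂tripleMeasure p (calP p Pth γ p.calE) (P.map fun ω => ‖T ω‖) := by
  have mS := hM.measurable_S
  have mT := hM.measurable_T
  have mg := hM.measurable_gsr
  have mh := hM.measurable_grt
  have hE := hp.calE_pos
  have hD := hp.calD_pos hγ
  have hK := hp.K_nonneg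
  have hwer := hp.wer_pos
  have hwmin := hp.wmin_pos
  set μ := P.map fun ω => ‖T ω‖ with hμ
  have hμp : IsProbabilityMeasure μ := Measure.isProbabilityMeasure_map (by fun_prop)
  have hcone : IsConeLaw p μ := hM.isConeLaw hp
  set Q := calP p Pth γ p.calE with hQ
  set μY := lawOfPDF (ricianPDF p) with hμY
  -- That the fading densities have total mass one is read off from the model, since they are laws
  -- of random variables.
  have hμYp : IsProbabilityMeasure μY := by
    rw [hμY, ← hM.aerial_fading.map_eq]
    exact Measure.isProbabilityMeasure_map (by fun_prop)
  have hμXp : IsProbabilityMeasure (lawOfPDF (shadowedRicianPDF p)) := by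
    rw [← hM.satellite_fading.map_eq]
    exact Measure.isProbabilityMeasure_map (by fun_prop)
  have hμWp : IsProbabilityMeasure (P.map fun ω => ‖S ω‖ ^ 2) :=
    Measure.isProbabilityMeasure_map (by fun_prop)
  -- the tail of the aerial link as a measurable function
  have htail : Measurable fun y : ℝ × ℝ => μY (Set.Ioi (tailLevel p γ y)) := by
    have : Antitone fun t : ℝ => μY (Set.Ioi t) := fun a b hab =>
      measure_mono (Set.Ioi_subset_Ioi hab)
    exact this.measurable.comp (measurable_tailLevel p γ)
  set H : ℝ → ENNReal := fun z => ∫⁻ v, μY (Set.Ioi (tailLevel p γ (z, v))) ∂μ with hH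
  have hHm : Measurable H := htail.lintegral_prod_right'
  have hfm := measurable_shadowedRicianPDF p
  have mjoint : Measurable fun ω =>
      ((‖S ω‖ ^ 2, ‖gsr ω‖ ^ 2), (‖T ω‖, ‖grt ω‖ ^ 2)) := by fun_prop
  have hmS := measurableSet_successSet p Pth γ
  have e1 : P {ω | γ < snrPIC1 p (S ω) (T ω) (gsr ω) (grt ω) ∧ rxPower p (S ω) (gsr ω) ≤ Pth} =
      P.map (fun ω => ((‖S ω‖ ^ 2, ‖gsr ω‖ ^ 2), (‖T ω‖, ‖grt ω‖ ^ 2))) (successSet p Pth γ) := by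
    rw [Measure.map_apply mjoint hmS]
    refine measure_congr ?_
    have hT0 : ∀ᵐ ω ∂P, 0 < ‖T ω‖ :=
      ae_of_ae_map (f := fun ω => ‖T ω‖) (by fun_prop) (hcone.ae_pos hp.h1_pos)
    filter_upwards [hT0] with ω hω
    exact propext (success_iff hp hγ hω _ _)
  -- Given the satellite link, the aerial link matters only through the excess `z`: `H z` is the
  -- conditional probability of success, and success is impossible outside `(0, 𝒫]`.
  have hsection : ∀ a : ℝ × ℝ, (μ.prod μY) (Prod.mk a ⁻¹' successSet p Pth γ) =
      (Set.Ioc 0 Q).indicator H (excess p γ a.1 a.2) := by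
    intro a
    rw [Measure.prod_apply (measurable_prodMk_left hmS)]
    by_cases ha : excess p γ a.1 a.2 ∈ Set.Ioc 0 Q
    · rw [Set.indicator_of_mem ha]
      refine lintegral_congr fun v => congrArg μY ?_
      ext y
      exact ⟨fun h => h.2, fun h => ⟨ha, h⟩⟩
    · rw [Set.indicator_of_notMem ha, ← lintegral_zero (μ := μ)]
      refine lintegral_congr fun v => ?_
      have : Prod.mk v ⁻¹' (Prod.mk a ⁻¹' successSet p Pth γ) = ∅ := by
        ext y
        simp only [Set.mem_preimage, Set.mem_empty_iff_false, iff_false]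
        exact fun h => ha h.1
      rw [this, measure_empty]
  set G : ℝ × (ℝ × ℝ) → ENNReal := fun x =>
    ENNReal.ofReal (1 / (2 * p.wer * p.wmin)) * (ENNReal.ofReal
        (x.1 / p.calE * shadowedRicianPDF p ((x.2.1 + p.calD γ) * x.1 / p.calE)) *
      μY (Set.Ioi (tailLevel p γ x.2))) with hG
  have hdens : Measurable fun q : ℝ × ℝ =>
      ENNReal.ofReal (q.1 / p.calE * shadowedRicianPDF p ((q.2 + p.calD γ) * q.1 / p.calE)) := by
    fun_prop
  have hGm : Measurable G :=
    ((hdens.comp (measurable_fst.prodMk (measurable_fst.comp measurable_snd))).mul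
      (htail.comp measurable_snd)).const_mul _
  have e2 : P.map (fun ω => ((‖S ω‖ ^ 2, ‖gsr ω‖ ^ 2), (‖T ω‖, ‖grt ω‖ ^ 2)))
      (successSet p Pth γ) = ∫⁻ x, G x ∂tripleMeasure p Q μ := by
    have hind : Measurable fun a : ℝ × ℝ => (Set.Ioc 0 Q).indicator H (excess p γ a.1 a.2) :=
      (hHm.indicator measurableSet_Ioc).comp (measurable_excess p γ)
    rw [hM.map_eq_prod, ← hμ, ← hμY, Measure.prod_apply hmS]
    simp only [hsection]
    rw [lintegral_prod _ hind.aemeasurable,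
      map_norm_sq_satellite hwer hwmin mS hM.satellite_uniform, lintegral_smul_measure,
      lintegral_prod _ hGm.aemeasurable, smul_eq_mul, ← lintegral_const_mul _
        hind.lintegral_prod_right']
    refine setLIntegral_congr_fun measurableSet_Ioc fun w hw => ?_
    have hw0 : 0 < w := (sq_nonneg _).trans_lt hw.1
    have mG : Measurable fun y => G (w, y) := hGm.comp measurable_prodMk_left
    have mt : ∀ z, Measurable fun v => μY (Set.Ioi (tailLevel p γ (z, v))) := fun z =>
      htail.comp measurable_prodMk_left
    have md : Measurable fun z => ENNReal.ofReal
        (w / p.calE * shadowedRicianPDF p ((z + p.calD γ) * w / p.calE)) :=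
      hdens.comp measurable_prodMk_left
    have mdH : Measurable fun z => ENNReal.ofReal
        (w / p.calE * shadowedRicianPDF p ((z + p.calD γ) * w / p.calE)) * H z := md.mul hHm
    rw [lintegral_lawOfPDF_excess hp hγ hw0 Q hfm hHm, lintegral_prod _ mG.aemeasurable,
      ← lintegral_const_mul _ mdH]
    refine lintegral_congr fun z => ?_
    simp only [hG, hH]
    rw [lintegral_const_mul _ ((mt z).const_mul _), lintegral_const_mul _ (mt z)]
  have hint := (psi1_eq_integral hp hcone hγ hE hP).1
  -- Non-negativity almost everywhere makes `ENNReal.ofReal` lossless and identifies the Lebesgue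
  -- integral with the real one.
  have hG2 : ∀ᵐ x ∂tripleMeasure p Q μ, 0 ≤ successDensity p γ p.calE x ∧
      G x = ENNReal.ofReal (successDensity p γ p.calE x) := by
    filter_upwards [ae_tripleMeasure hp hcone Q] with x hx
    obtain ⟨⟨hw, -⟩, ⟨hz, -⟩, hv⟩ := hx
    have ht := tailLevel_nonneg hp hγ hz hv
    have hr := ricianTail_nonneg hK ht
    have hs := hp.shadowedRicianPDF_nonneg (x := (x.2.1 + p.calD γ) * x.1 / p.calE)
      (by positivity)
    have hd : 0 ≤ x.1 / p.calE * shadowedRicianPDF p ((x.2.1 + p.calD γ) * x.1 / p.calE) := by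
      positivity
    refine ⟨?_, ?_⟩
    · unfold successDensity
      positivity
    · simp only [hG]
      rw [hμY, lawOfPDF_rician_Ioi hK ht, ← ENNReal.ofReal_mul hd, ← ENNReal.ofReal_mul
        (by positivity), successDensity, ← mul_assoc]
  rw [P5, measureReal_def, e1, e2, integral_eq_lintegral_of_nonneg_ae (hG2.mono fun _ h => h.1)
    hint.aestronglyMeasurable, lintegral_congr_ae (hG2.mono fun _ h => h.2)]

/-- The success probability is right-continuous in the threshold power. -/
lemma tendsto_P5 (hM : IsModel P p S T gsr grt) (Pth γ : ℝ) :
    Tendsto (fun x => P5 P p S T gsr grt x γ) (𝓝[>] Pth) (𝓝 (P5 P p S T gsr grt Pth γ)) := by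
  set s : ℝ → Set Ω := fun x =>
    {ω | γ < snrPIC1 p (S ω) (T ω) (gsr ω) (grt ω) ∧ rxPower p (S ω) (gsr ω) ≤ x} with hs
  -- Continuity from above: as the power constraint is not strict, the events decrease to the one at
  -- `Pth`.
  have h := tendsto_measure_biInter_gt (μ := P) (s := s) (a := Pth)
    (fun r _ => (hM.measurableSet_success r γ).nullMeasurableSet)
    (fun i j _ hij ω hω => ⟨hω.1, hω.2.trans hij⟩)
    ⟨Pth + 1, by simp, measure_ne_top _ _⟩
  have hinter : ⋂ r > Pth, s r = s Pth := by
    ext ω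
    simp only [Set.mem_iInter, hs, Set.mem_ofPred_eq]
    constructor
    · intro h
      exact ⟨(h (Pth + 1) (by simp)).1, le_of_forall_gt_imp_ge_of_dense fun r hr => (h r hr).2⟩
    · intro h r hr
      exact ⟨h.1, h.2.trans (le_of_lt hr)⟩
  rw [hinter] at h
  exact (ENNReal.tendsto_toReal (measure_ne_top _ _)).comp h

end Model

lemma calP_calE_pos_iff {p : Params} (hp : p.Admissible) {Pth γ : ℝ} :
    0 < calP p Pth γ p.calE ↔ p.calD γ / p.calE * p.ηs < Pth := by
  rw [calP, sub_pos, lt_div_iff₀ hp.ηs_pos, div_mul_eq_mul_div, div_lt_iff₀ hp.calE_pos]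

lemma psiBar1_eq_P5 {Ω : Type*} [MeasurableSpace Ω] {P : Measure Ω} [IsProbabilityMeasure P]
    {p : Params} (hp : p.Admissible) {S T : Ω → Space} {gsr grt : Ω → ℂ}
    (hM : IsModel P p S T gsr grt) {Pth γ : ℝ} (hγ : 0 < γ)
    (h : p.calD γ / p.calE * p.ηs < Pth) :
    Psi1Converges p Pth γ p.calE ∧ P5 P p S T gsr grt Pth γ = PsiBar1 p Pth γ := by
  have hP := (calP_calE_pos_iff hp).2 h
  have mT := hM.measurable_T
  have hμp : IsProbabilityMeasure (P.map fun ω => ‖T ω‖) :=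
    Measure.isProbabilityMeasure_map (by fun_prop)
  have hcone := hM.isConeLaw hp
  exact ⟨psi1Converges hp hcone hγ hp.calE_pos hP, (P5_eq_integral hp hM hγ hP).trans
    (psi1_eq_integral hp hcone hγ hp.calE_pos hP).2.symm⟩

end A2A

end

theorem theorem5 {Ω : Type*} [MeasurableSpace Ω] (P : Measure Ω) [IsProbabilityMeasure P]
    (p : A2A.Params) (hp : p.Admissible)
    (S T : Ω → A2A.Space) (gsr grt : Ω → ℂ) (hM : A2A.IsModel P p S T gsr grt)
    (Pth γ : ℝ) (hPth : 0 < Pth) (hγ : 0 < γ) :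
    (γ < 1 / p.μ' → p.calD γ / p.calE * p.ηs < Pth →
      A2A.Psi1Converges p Pth γ p.calE ∧
        A2A.P5 P p S T gsr grt Pth γ = A2A.PsiBar1 p Pth γ) ∧
    (γ < 1 / p.μ' → Pth = p.calD γ / p.calE * p.ηs →
      Tendsto (fun x : ℝ => A2A.PsiBar1 p x γ) (𝓝[>] Pth)
        (𝓝 (A2A.P5 P p S T gsr grt Pth γ)) ∧
      A2A.P5 P p S T gsr grt Pth γ = 0) ∧
    (Pth < p.calD γ / p.calE * p.ηs → A2A.P5 P p S T gsr grt Pth γ = 0) := by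

  refine ⟨fun _ h => A2A.psiBar1_eq_P5 hp hM hγ h, fun _ h => ?_, fun h => ?_⟩
  -- To the right of the boundary the series equals the probability, so it inherits the one-sided
  -- limit without any asymptotics of Meijer functions.
  · refine ⟨(A2A.tendsto_P5 hM Pth γ).congr' ?_, A2A.P5_eq_zero hp hγ ?_⟩
    · filter_upwards [self_mem_nhdsWithin] with x hx
      exact (A2A.psiBar1_eq_P5 hp hM hγ (h ▸ hx)).2
    · exact not_lt.1 (mt (A2A.calP_calE_pos_iff hp).1 h.not_gt)
  · exact A2A.P5_eq_zero hp hγ (not_lt.1 (mt (A2A.calP_calE_pos_iff hp).1 h.not_gt))
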